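/- Define a sequence $(a(n))_{n\ge 0}$ by $a(0)=1$ and \[ a(n)=\frac12\sum_{i=1}^{n}\frac{i(n-i+1)}{n+2}\binom{n-1}{i-1}\binom{n+3}{i+1}\,a(i-1)\,a(n-i)\qquad(n\ge 1), \] and define a sequence $(v_n)_{n\ge 3}$ by $v_3=1$ and \[ v_n=\frac12\sum_{i=1}^{n-3}\frac{i(n-i-2)}{n-1}\binom{n-4}{i-1}\binom{n}{i+1}\,v_{i+2}\,v_{n-i}\qquad(n\ge 4). \] A border-strip is a nonempty (edge-)connected skew shape containing no $2\times 2$ block of boxes. Let $\mathrm{BSD}(2n\times n,n)$ be the set of all set partitions of the boxes of the $2n\times n$ rectangle ($2n$ rows, $n$ columns) into border-strips, each consisting of exactly $n$ boxes (so there are $2n$ of them). Then for every integer $n\ge 0$, \[ a(n)=v_{n+3}=\bigl|\mathrm{BSD}(2n\times n,n)\bigr|, \] where for $n=0$ the rectangle is empty and its only decomposition is the empty one. -/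

import Mathlib

/-- The sequence `a(0), a(1), …` with `a(0) = 1` and, for `n ≥ 1`,
`a(n) = 1/2 ∑_{i=1}^{n} i(n-i+1)/(n+2) · C(n-1,i-1) · C(n+3,i+1) · a(i-1) · a(n-i)`. -/
def aSeq (n : ℕ) : ℚ :=
  if n = 0 then 1
  else (1 / 2) * ∑ i ∈ (Finset.Icc 1 n).attach,
    ((i.1 : ℚ) * ((n : ℚ) - (i.1 : ℚ) + 1) / ((n : ℚ) + 2)) *
      ((n - 1).choose (i.1 - 1) : ℚ) * ((n + 3).choose (i.1 + 1) : ℚ) *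
      aSeq (i.1 - 1) * aSeq (n - i.1)
termination_by n
decreasing_by
  all_goals
    have h := Finset.mem_Icc.mp i.2
    omega

theorem aSeq_zero : aSeq 0 = 1 := by
  rw [aSeq]
  simp

theorem aSeq_rec (n : ℕ) (hn : 1 ≤ n) :
    aSeq n = (1 / 2) * ∑ i ∈ Finset.Icc 1 n,
      ((i : ℚ) * ((n : ℚ) - (i : ℚ) + 1) / ((n : ℚ) + 2)) *
        ((n - 1).choose (i - 1) : ℚ) * ((n + 3).choose (i + 1) : ℚ) *
        aSeq (i - 1) * aSeq (n - i) := by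
  rw [aSeq, if_neg (by omega)]
  congr 1
  exact Finset.sum_attach (Finset.Icc 1 n) fun i =>
    ((i : ℚ) * ((n : ℚ) - (i : ℚ) + 1) / ((n : ℚ) + 2)) *
      ((n - 1).choose (i - 1) : ℚ) * ((n + 3).choose (i + 1) : ℚ) *
      aSeq (i - 1) * aSeq (n - i)

/-- Zograf's sequence `v_3, v_4, …` with `v_3 = 1` and, for `n ≥ 4`,
`v_n = 1/2 ∑_{i=1}^{n-3} i(n-i-2)/(n-1) · C(n-4,i-1) · C(n,i+1) · v_{i+2} · v_{n-i}`.
The sequence starts at index `3`; the values at `0, 1, 2` are set to `0` and never used. -/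
def zografV (n : ℕ) : ℚ :=
  if n < 3 then 0
  else if n = 3 then 1
  else (1 / 2) * ∑ i ∈ (Finset.Icc 1 (n - 3)).attach,
    ((i.1 : ℚ) * ((n : ℚ) - (i.1 : ℚ) - 2) / ((n : ℚ) - 1)) *
      ((n - 4).choose (i.1 - 1) : ℚ) * (n.choose (i.1 + 1) : ℚ) *
      zografV (i.1 + 2) * zografV (n - i.1)
termination_by n
decreasing_by
  all_goals
    have h := Finset.mem_Icc.mp i.2
    omega

theorem zografV_three : zografV 3 = 1 := by
  rw [zografV]
  simp

theorem zografV_rec (n : ℕ) (hn : 4 ≤ n) :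
    zografV n = (1 / 2) * ∑ i ∈ Finset.Icc 1 (n - 3),
      ((i : ℚ) * ((n : ℚ) - (i : ℚ) - 2) / ((n : ℚ) - 1)) *
        ((n - 4).choose (i - 1) : ℚ) * (n.choose (i + 1) : ℚ) *
        zografV (i + 2) * zografV (n - i) := by
  rw [zografV, if_neg (by omega), if_neg (by omega)]
  congr 1
  exact Finset.sum_attach (Finset.Icc 1 (n - 3)) fun i =>
    ((i : ℚ) * ((n : ℚ) - (i : ℚ) - 2) / ((n : ℚ) - 1)) *
      ((n - 4).choose (i - 1) : ℚ) * (n.choose (i + 1) : ℚ) *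
      zografV (i + 2) * zografV (n - i)

/-- A finite set of boxes (row, column) is a skew shape if it is the difference `lam / mu` of two
Young diagrams `mu ⊆ lam`. -/
def IsSkewShape (B : Finset (ℕ × ℕ)) : Prop :=
  ∃ lam mu : YoungDiagram, mu ≤ lam ∧ B = lam.cells \ mu.cells

/-- The graph on boxes (row, column) in which two boxes are adjacent when they share an edge. -/
def boxGraph : SimpleGraph (ℕ × ℕ) :=
  SimpleGraph.boxProd (SimpleGraph.hasse ℕ) (SimpleGraph.hasse ℕ)

/-- A border-strip: a (nonempty) connected skew shape that contains no `2 × 2` block of boxes. -/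
def IsBorderStrip (B : Finset (ℕ × ℕ)) : Prop :=
  IsSkewShape B ∧ (boxGraph.induce (B : Set (ℕ × ℕ))).Connected ∧
    ∀ i j : ℕ, ¬ (({(i, j), (i, j + 1), (i + 1, j), (i + 1, j + 1)} : Finset (ℕ × ℕ)) ⊆ B)

/-- Border-strip decompositions of a diagram `D` of type `mu`: the set partitions of the boxes of
`D` into border-strips whose multiset of sizes is `mu`. -/
def BSD (D : Finset (ℕ × ℕ)) (mu : Multiset ℕ) : Set (Finpartition D) :=
  {P | (∀ B ∈ P.parts, IsBorderStrip B) ∧ P.parts.val.map Finset.card = mu}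

/-- The rectangular diagram with `r` rows and `c` columns. -/
def rectangle (r c : ℕ) : Finset (ℕ × ℕ) :=
  Finset.range r ×ˢ Finset.range c

/-!
# Border-strip decompositions of the `2n × n` rectangle

Both recursions agree after a shift of the index, so the point is to identify the number of
decompositions with the solution of the recursion.

*Peeling.* A diagram with `n` columns is encoded by `n` beads, and a border-strip with `n` boxes can
be removed from it exactly when some bead can be moved down by `n` (`exists_eq_rimStrip`). Starting
from the rectangle, every residue class modulo `n` contains one bead, at level `0`, `1` or `2`; the
rectangle has all levels two and the empty diagram all levels zero. Every decomposition of a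
nonempty diagram contains a removable strip (`IsStripTiling.exists_isLowerSet_sdiff`). It contains
at most two, because distinct ones occupy disjoint sets of `n` diagonals out of `3n - 1`, and if
there are two, they come from a label `i` of level one and a label `j > i` of level two.
Inclusion-exclusion gives `N(l) = ∑ N(l - eᵢ) - ∑ N(l - eᵢ - eⱼ)` for the number `N(l)` of
decompositions (`tilingCount_rec`).

*Solving the recursion.* Let `S(x, t) = ∑ (-1)ᵐ xᵐ⁺¹ tᵐ / (m! (m+1)!)` and `J = ∂ₓ S`. Reading the
labels in increasing order, start from `exp (x - S)`, multiply by `S` for a label of level one and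
apply `∂ₜ` for a label of level two. Since `∂ₓ S = J`, `∂ₜ J = -S` and `J = 1` at `t = 0`, the
derivative with respect to `x` of the result at `t = 0` is given by the right-hand side of the
recursion (`twistX_stateSeries`). The functional `xᵏ ↦ k!` takes the same value on `p` and on `p'`
if `p(0) = 0`, so its value on this polynomial is `N(l)` (`tilingCount_eq_stateCount`). The factor
`exp (x - S)` is never formed: the operators `∂ₜ` and `∂ₓ` are conjugated by it instead.

*The inverse Bessel series.* For the rectangle the result is `n!` times the `n`-th coefficient of
`∫ exp (-S(x, t)) dx`. As `t S(x, t) = b(x t)` with the Bessel series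
`b(w) = ∑ (-1)ᵐ wᵐ⁺¹ / (m! (m+1)!)`, the substitution `u = b(x t)` gives `n! (n+1)! [uⁿ⁺¹] y` with
`y` the compositional inverse of `b` (`laplaceCoeff_one`). The Bessel equation `w b'' = -b` becomes
a quadratic differential relation for the iterated antiderivatives of `y` (`besselInv_quadratic`),
whose coefficients are the recursion for `aSeq` (`aSeq_eq_besselNumber`).
-/

namespace BorderStripCount

/-! ### The Bessel series and its compositional inverse -/

section Bessel

open PowerSeries
open scoped Nat

/-- The series `∑ₘ (-1)ᵐ wᵐ⁺¹ / (m! (m+1)!)`, that is `√w J₁(2√w)` for the Bessel function `J₁`. -/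
noncomputable def bessel : ℚ⟦X⟧ :=
  PowerSeries.mk fun k => if k = 0 then 0 else (-1) ^ (k - 1) / ((k - 1)! * k !)

theorem coeff_succ_bessel (m : ℕ) : coeff (m + 1) bessel = (-1) ^ m / (m ! * (m + 1)!) := by
  simp [bessel]

theorem constantCoeff_bessel : constantCoeff bessel = 0 := by
  simp [bessel, ← coeff_zero_eq_constantCoeff_apply]

theorem coeff_one_bessel : coeff 1 bessel = 1 := by
  simpa using coeff_succ_bessel 0

noncomputable instance : Invertible (coeff 1 bessel) :=
  ⟨1, by simp [coeff_one_bessel], by simp [coeff_one_bessel]⟩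

theorem hasSubst_bessel : HasSubst bessel :=
  HasSubst.of_constantCoeff_zero' constantCoeff_bessel

theorem X_mul_derivative_derivative_bessel :
    (X : ℚ⟦X⟧) * d⁄dX ℚ (d⁄dX ℚ bessel) = -bessel := by
  ext k
  rcases k with _ | k
  · simp [constantCoeff_bessel]
  · rw [coeff_succ_X_mul, coeff_derivative, coeff_derivative, coeff_succ_bessel, map_neg,
      coeff_succ_bessel]
    have h1 : (k ! : ℚ) ≠ 0 := by exact_mod_cast k.factorial_ne_zero
    simp only [Nat.factorial_succ]
    push_cast
    have h2 : (k : ℚ) + 1 ≠ 0 := by positivity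
    have h3 : (k : ℚ) + 1 + 1 ≠ 0 := by positivity
    field_simp
    ring

theorem derivative_bessel_ne_zero : d⁄dX ℚ bessel ≠ 0 := by
  intro h
  have := congrArg (coeff 0) h
  rw [coeff_derivative, coeff_one_bessel] at this
  simp at this

/-- The compositional inverse of `bessel`. -/
noncomputable def besselInv : ℚ⟦X⟧ := bessel.substInv

theorem besselInv_subst : besselInv.subst bessel = (X : ℚ⟦X⟧) :=
  subst_substInv_left bessel constantCoeff_bessel

theorem derivative_besselInv_subst :
    (d⁄dX ℚ besselInv).subst bessel * d⁄dX ℚ bessel = 1 := by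
  rw [← derivative_subst hasSubst_bessel, besselInv_subst, derivative_X]

/-- Substituting `bessel` is injective, since `bessel` has a compositional inverse. -/
theorem eq_zero_of_subst_bessel {f : ℚ⟦X⟧} (h : f.subst bessel = (0 : ℚ⟦X⟧)) : f = 0 := by
  have hY : HasSubst besselInv := HasSubst.substInv bessel
  have h1 := subst_comp_subst_apply hasSubst_bessel hY f
  have h2 : bessel.subst besselInv = (X : ℚ⟦X⟧) := subst_substInv_right bessel constantCoeff_bessel
  rw [h, h2, X_subst, ← coe_substAlgHom hY, map_zero] at h1
  exact h1.symm

/-- The antiderivative of a power series with constant term zero. -/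
noncomputable def antideriv (f : ℚ⟦X⟧) : ℚ⟦X⟧ :=
  PowerSeries.mk fun k => coeff (k - 1) f / k

theorem coeff_succ_antideriv (f : ℚ⟦X⟧) (k : ℕ) :
    coeff (k + 1) (antideriv f) = coeff k f / (k + 1) := by
  simp [antideriv]

theorem constantCoeff_antideriv (f : ℚ⟦X⟧) : constantCoeff (antideriv f) = 0 := by
  rw [← coeff_zero_eq_constantCoeff_apply, antideriv, coeff_mk]
  simp

theorem derivative_antideriv (f : ℚ⟦X⟧) : d⁄dX ℚ (antideriv f) = f := by
  ext k
  rw [coeff_derivative, coeff_succ_antideriv]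
  have : (k : ℚ) + 1 ≠ 0 := by positivity
  field_simp

theorem antideriv_besselInv_subst :
    (antideriv besselInv).subst bessel = X * bessel - bessel + X * d⁄dX ℚ bessel := by
  apply derivative.ext
  · rw [derivative_subst hasSubst_bessel, derivative_antideriv, besselInv_subst]
    simp only [map_add, map_sub, Derivation.leibniz, smul_eq_mul, derivative_X,
      X_mul_derivative_derivative_bessel]
    ring
  · have h0 := constantCoeff_subst_eq_zero (S := ℚ) (τ := Unit) constantCoeff_bessel _
      (constantCoeff_antideriv besselInv)
    rw [show constantCoeff ((antideriv besselInv).subst bessel) = 0 from h0]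
    simp [constantCoeff_bessel]

/-- The first order relation satisfied by the inverse Bessel series `y` and `h = ∫ y`; in terms of
the variable `w` of `bessel` it is the Bessel equation. -/
theorem besselInv_first_order :
    X * d⁄dX ℚ besselInv - besselInv -
      (X * besselInv - antideriv besselInv) * d⁄dX ℚ besselInv = 0 := by
  apply eq_zero_of_subst_bessel
  apply (mul_eq_zero.mp _).resolve_right derivative_bessel_ne_zero
  have hs := hasSubst_bessel
  rw [← coe_substAlgHom hs]
  simp only [map_sub, map_mul]
  simp only [coe_substAlgHom hs, besselInv_subst, antideriv_besselInv_subst, subst_X hs]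
  linear_combination (bessel - (bessel * X - (X * bessel - bessel + X * d⁄dX ℚ bessel))) *
    derivative_besselInv_subst

/-- The quadratic relation behind the quadratic recursion for `aSeq`: it is the first order relation
multiplied by `2x` and integrated. -/
theorem besselInv_quadratic :
    2 * (X ^ 2 * besselInv - 3 * (X * antideriv besselInv) +
      3 * antideriv (antideriv besselInv)) = (X * besselInv - antideriv besselInv) ^ 2 := by
  apply derivative.ext
  · have h2 : (2 : ℚ⟦X⟧) = C 2 := (map_ofNat C 2).symm
    have h3 : (3 : ℚ⟦X⟧) = C 3 := (map_ofNat C 3).symm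
    simp only [h2, h3, pow_two, map_add, map_sub, Derivation.leibniz, smul_eq_mul, derivative_X,
      derivative_C, derivative_antideriv]
    rw [← h2, ← h3]
    linear_combination (2 * X) * besselInv_first_order
  · simp [constantCoeff_antideriv]

/-- The numbers `n! (n+1)! [xⁿ⁺¹]` of the inverse Bessel series. -/
noncomputable def besselNumber (n : ℕ) : ℚ := n ! * (n + 1)! * coeff (n + 1) besselInv

theorem coeff_succ_besselInv (k : ℕ) :
    coeff (k + 1) besselInv = besselNumber k / (k ! * (k + 1)!) := by
  have h1 : (k ! : ℚ) ≠ 0 := by exact_mod_cast k.factorial_ne_zero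
  have h2 : ((k + 1)! : ℚ) ≠ 0 := by exact_mod_cast (k + 1).factorial_ne_zero
  rw [besselNumber]
  field_simp

theorem coeff_antideriv_besselInv (k : ℕ) :
    coeff (k + 2) (antideriv besselInv) = besselNumber k / (k ! * (k + 2)!) := by
  rw [coeff_succ_antideriv, coeff_succ_besselInv, Nat.factorial_succ (k + 1)]
  push_cast
  rw [div_div]
  ring_nf

theorem coeff_antideriv_antideriv_besselInv (k : ℕ) :
    coeff (k + 3) (antideriv (antideriv besselInv)) = besselNumber k / (k ! * (k + 3)!) := by
  rw [coeff_succ_antideriv, coeff_antideriv_besselInv, Nat.factorial_succ (k + 2)]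
  push_cast
  rw [div_div]
  ring_nf

theorem X_mul_besselInv_sub_antideriv :
    X * besselInv - antideriv besselInv =
      X ^ 2 * PowerSeries.mk fun j => besselNumber j * (j + 1) / (j ! * (j + 2)!) := by
  ext k
  rcases k with _ | _ | k
  · simp [constantCoeff_antideriv, pow_two, mul_assoc]
  · rw [map_sub, coeff_succ_X_mul, coeff_succ_antideriv, coeff_X_pow_mul']
    simp
  · rw [map_sub, coeff_succ_X_mul, coeff_succ_besselInv, coeff_antideriv_besselInv,
      show k + 1 + 1 = k + 2 by ring, coeff_X_pow_mul, coeff_mk, Nat.factorial_succ (k + 1)]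
    have h1 : (k ! : ℚ) ≠ 0 := by exact_mod_cast k.factorial_ne_zero
    have h2 : ((k + 1)! : ℚ) ≠ 0 := by exact_mod_cast (k + 1).factorial_ne_zero
    push_cast
    have h3 : (k : ℚ) + 1 + 1 ≠ 0 := by positivity
    field_simp
    ring

/-- The coefficients of `besselInv_quadratic`. -/
theorem besselNumber_succ (m : ℕ) :
    2 * ((m + 1) * (m + 3)) * (besselNumber (m + 1) / ((m + 1)! * (m + 4)!)) =
      ∑ p ∈ Finset.HasAntidiagonal.antidiagonal m,
        (besselNumber p.1 * (p.1 + 1) / (p.1 ! * (p.1 + 2)!)) *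
          (besselNumber p.2 * (p.2 + 1) / (p.2 ! * (p.2 + 2)!)) := by
  have h := congrArg (coeff (m + 4)) besselInv_quadratic
  rw [X_mul_besselInv_sub_antideriv, mul_pow, ← pow_mul] at h
  have h2 : (2 : ℚ⟦X⟧) = C 2 := (map_ofNat C 2).symm
  have h3 : (3 : ℚ⟦X⟧) = C 3 := (map_ofNat C 3).symm
  rw [h2, h3, coeff_C_mul, map_add, map_sub, coeff_C_mul, coeff_C_mul,
    show m + 4 = (m + 2) + 2 by ring, coeff_X_pow_mul, show m + 2 + 2 = (m + 1 + 2) + 1 by ring,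
    coeff_succ_X_mul, coeff_antideriv_besselInv, coeff_succ_besselInv,
    show m + 1 + 2 + 1 = (m + 1) + 3 by ring, coeff_antideriv_antideriv_besselInv,
    show m + 1 + 3 = m + 2 * 2 by ring, coeff_X_pow_mul, pow_two, coeff_mul] at h
  simp only [coeff_mk] at h
  rw [← h, show m + 2 * 2 = m + 4 by ring, show m + 1 + 2 = m + 3 by ring,
    show m + 1 + 1 = m + 2 by ring, Nat.factorial_succ (m + 3), Nat.factorial_succ (m + 2)]
  have h1 : ((m + 1)! : ℚ) ≠ 0 := by exact_mod_cast (m + 1).factorial_ne_zero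
  have h2 : ((m + 2)! : ℚ) ≠ 0 := by exact_mod_cast (m + 2).factorial_ne_zero
  push_cast
  have h4 : (m : ℚ) + 2 + 1 ≠ 0 := by positivity
  have h5 : (m : ℚ) + 3 + 1 ≠ 0 := by positivity
  field_simp
  ring

theorem besselNumber_zero : besselNumber 0 = 1 := by
  simp [besselNumber, besselInv, coeff_one_substInv, coeff_one_bessel]

theorem aSeq_eq_besselNumber (n : ℕ) : aSeq n = besselNumber n := by
  induction n using Nat.strong_induction_on with
  | _ n ih =>
    rcases n with _ | m
    · rw [aSeq_zero, besselNumber_zero]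
    have key := besselNumber_succ m
    have hm1 : ((m + 1)! : ℚ) ≠ 0 := by exact_mod_cast (m + 1).factorial_ne_zero
    have hm4 : ((m + 4)! : ℚ) ≠ 0 := by exact_mod_cast (m + 4).factorial_ne_zero
    have h1 : (m : ℚ) + 1 ≠ 0 := by positivity
    have h3 : (m : ℚ) + 3 ≠ 0 := by positivity
    have h4 : besselNumber (m + 1) = 1 / 2 * (((m + 1)! * (m + 4)!) / ((m + 1) * (m + 3)) *
        (2 * ((m + 1) * (m + 3)) * (besselNumber (m + 1) / ((m + 1)! * (m + 4)!)))) := by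
      field_simp
    rw [h4, key, aSeq_rec (m + 1) (by omega),
      Finset.Nat.sum_antidiagonal_eq_sum_range_succ_mk]
    rw [← Finset.Ico_add_one_right_eq_Icc, Finset.sum_Ico_eq_sum_range]
    congr 1
    rw [Finset.mul_sum, show m + 1 + 1 - 1 = m.succ by omega]
    refine Finset.sum_congr rfl fun j hj => ?_
    obtain ⟨k, rfl⟩ : ∃ k, m = j + k := ⟨m - j, by have := Finset.mem_range.mp hj; omega⟩
    rw [add_comm 1 j, show j + k + 1 - 1 = j + k by omega, show j + 1 - 1 = j by omega,
      show j + k + 1 + 3 = (j + 2) + (k + 2) by omega, show j + 1 + 1 = j + 2 by omega,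
      show j + k + 1 - (j + 1) = k by omega, Nat.choose_symm_add, Nat.choose_symm_add,
      Nat.add_choose, Nat.add_choose,
      Nat.cast_div (Nat.factorial_mul_factorial_dvd_factorial_add _ _) (by positivity),
      Nat.cast_div (Nat.factorial_mul_factorial_dvd_factorial_add _ _) (by positivity),
      ih j (by omega), ih k (by omega)]
    dsimp only
    rw [show j + k - j = k by omega,
      show j + 2 + (k + 2) = j + k + 4 by omega, Nat.factorial_succ (j + k)]
    push_cast
    have a1 : (j ! : ℚ) ≠ 0 := by exact_mod_cast j.factorial_ne_zero
    have a2 : (k ! : ℚ) ≠ 0 := by exact_mod_cast k.factorial_ne_zero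
    have a3 : ((j + 2)! : ℚ) ≠ 0 := by exact_mod_cast (j + 2).factorial_ne_zero
    have a4 : ((k + 2)! : ℚ) ≠ 0 := by exact_mod_cast (k + 2).factorial_ne_zero
    have a5 : (j : ℚ) + k + 1 ≠ 0 := by positivity
    have a6 : (j : ℚ) + k + 3 ≠ 0 := by positivity
    have a7 : (j : ℚ) + k + 1 + 2 ≠ 0 := by positivity
    field_simp
    ring

theorem aSeq_eq_zografV (n : ℕ) : aSeq n = zografV (n + 3) := by
  induction n using Nat.strong_induction_on with
  | _ n ih =>
    rcases Nat.eq_zero_or_pos n with rfl | hn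
    · rw [aSeq_zero, zografV_three]
    rw [aSeq_rec n hn, zografV_rec (n + 3) (by omega), Nat.add_sub_cancel]
    congr 1
    refine Finset.sum_congr rfl fun i hi => ?_
    have hi := Finset.mem_Icc.mp hi
    rw [ih (i - 1) (by omega), ih (n - i) (by omega), show n + 3 - 4 = n - 1 by omega,
      show i - 1 + 3 = i + 2 by omega, show n - i + 3 = n + 3 - i by omega]
    push_cast
    congr 4
    congr 1
    · congr 1
      ring
    · ring

end Bessel

/-! ### Twisted derivatives of bivariate series and a formal Laplace transform -/

section Laplace

open PowerSeries
open scoped Nat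

theorem derivative_mul {R : Type*} [CommRing R] (F G : R⟦X⟧) :
    d⁄dX R (F * G) = F * d⁄dX R G + G * d⁄dX R F := by
  rw [Derivation.leibniz, smul_eq_mul, smul_eq_mul]

/-- Power series in `t` whose coefficients are polynomials in `x`. -/
abbrev BivSeries : Type := PowerSeries (Polynomial ℚ)

/-- The derivative with respect to `x`, taken coefficientwise. -/
noncomputable def derivX : BivSeries →+ BivSeries where
  toFun F := PowerSeries.mk fun n => Polynomial.derivative (coeff n F)
  map_zero' := by ext1 n; simp
  map_add' F G := by ext1 n; simp

theorem coeff_derivX (n : ℕ) (F : BivSeries) :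
    coeff n (derivX F) = Polynomial.derivative (coeff n F) := by
  simp [derivX]

theorem derivX_mul (F G : BivSeries) : derivX (F * G) = F * derivX G + G * derivX F := by
  ext1 n
  rw [mul_comm G]
  simp only [coeff_derivX, map_add, coeff_mul, map_sum, Polynomial.derivative_mul,
    Finset.sum_add_distrib]
  rw [add_comm]

theorem derivX_one : derivX 1 = 0 := by
  have h := derivX_mul 1 1
  simpa using h

/-- The derivative with respect to `t`. -/
noncomputable def derivT : BivSeries →+ BivSeries where
  toFun F := d⁄dX (Polynomial ℚ) F
  map_zero' := map_zero _
  map_add' := map_add _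

theorem coeff_derivT (n : ℕ) (F : BivSeries) :
    coeff n (derivT F) = coeff (n + 1) F * (n + 1) :=
  coeff_derivative F n

theorem derivT_mul (F G : BivSeries) : derivT (F * G) = F * derivT G + G * derivT F :=
  derivative_mul F G

theorem derivT_one : derivT 1 = 0 := derivative_one

theorem derivT_X : derivT X = 1 := derivative_X

/-- The series `S = ∑ₘ (-1)ᵐ xᵐ⁺¹ tᵐ / (m! (m+1)!)`, so that `t S` is `bessel` at `x t`. -/
noncomputable def serS : BivSeries :=
  PowerSeries.mk fun m =>
    Polynomial.C ((-1) ^ m / (m ! * (m + 1)!) : ℚ) * Polynomial.X ^ (m + 1)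

/-- The series `J = ∑ₘ (-1)ᵐ xᵐ tᵐ / m!²`, the derivative of `S` with respect to `x`. -/
noncomputable def serJ : BivSeries :=
  PowerSeries.mk fun m => Polynomial.C ((-1) ^ m / (m ! * m !) : ℚ) * Polynomial.X ^ m

theorem derivX_serS : derivX serS = serJ := by
  ext1 n
  rw [coeff_derivX, serS, serJ, coeff_mk, coeff_mk, Polynomial.derivative_C_mul_X_pow]
  congr 2
  have h1 : (n ! : ℚ) ≠ 0 := by exact_mod_cast n.factorial_ne_zero
  have h2 : (n : ℚ) + 1 ≠ 0 := by positivity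
  rw [Nat.factorial_succ]
  push_cast
  field_simp

theorem derivX_serS_pow (k : ℕ) :
    derivX (serS ^ (k + 1)) = (k + 1) • (serJ * serS ^ k) := by
  induction k with
  | zero => simp [derivX_serS]
  | succ k ih =>
    rw [pow_succ', derivX_mul, ih, derivX_serS]
    simp only [nsmul_eq_mul]
    push_cast
    ring

theorem derivT_serJ : derivT serJ = -serS := by
  ext1 n
  rw [coeff_derivT, serS, serJ, coeff_mk, map_neg, coeff_mk]
  have h1 : (n ! : ℚ) ≠ 0 := by exact_mod_cast n.factorial_ne_zero
  have h2 : (n : ℚ) + 1 ≠ 0 := by positivity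
  have h3 : ((n : Polynomial ℚ) + 1) = Polynomial.C ((n : ℚ) + 1) := by simp
  rw [h3, mul_right_comm, ← Polynomial.C_mul, ← neg_mul, ← Polynomial.C_neg]
  congr 2
  rw [Nat.factorial_succ]
  push_cast
  field_simp
  ring

theorem derivX_derivT (F : BivSeries) : derivX (derivT F) = derivT (derivX F) := by
  ext1 n
  have h3 : ((n : Polynomial ℚ) + 1) = Polynomial.C ((n : ℚ) + 1) := by simp
  rw [coeff_derivX, coeff_derivT, coeff_derivT, coeff_derivX, h3,
    Polynomial.derivative_mul, Polynomial.derivative_C, mul_zero, add_zero]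

/-- The operator `∂ₜ - Sₜ`, that is `∂ₜ` conjugated by `exp (x - S)`. -/
noncomputable def twistT : BivSeries →+ BivSeries :=
  derivT - AddMonoidHom.mulLeft (derivT serS)

/-- The operator `∂ₓ + 1 - J`, that is `∂ₓ` conjugated by `exp (x - S)`. -/
noncomputable def twistX : BivSeries →+ BivSeries :=
  derivX + AddMonoidHom.mulLeft (1 - serJ)

theorem twistT_apply (F : BivSeries) : twistT F = derivT F - derivT serS * F := rfl

theorem twistX_apply (F : BivSeries) : twistX F = derivX F + (1 - serJ) * F := rfl

theorem twistX_twistT (F : BivSeries) : twistX (twistT F) = twistT (twistX F) := by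
  have h1 : derivX (derivT serS) = -serS := by rw [derivX_derivT, derivX_serS, derivT_serJ]
  have h2 : derivT (1 - serJ) = serS := by
    rw [map_sub, derivT_serJ, derivT_one]
    ring
  simp only [twistT_apply, twistX_apply, map_sub, map_add, derivX_mul, derivT_mul, h1]
  simp only [← map_sub, h2, derivX_derivT]
  ring

theorem twistX_serS_mul (F : BivSeries) :
    twistX (serS * F) = serS * twistX F + serJ * F := by
  simp only [twistX_apply, derivX_mul, derivX_serS]
  ring

theorem twistT_serJ_mul (F : BivSeries) :
    twistT (serJ * F) = serJ * twistT F - serS * F := by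
  simp only [twistT_apply, derivT_mul, derivT_serJ]
  ring

theorem twistT_X_mul (F : BivSeries) : twistT (X * F) = X * twistT F + F := by
  simp only [twistT_apply, derivT_mul, derivT_X]
  ring

/-- The linear functional `xᵏ ↦ k!`, that is `p ↦ ∫₀^∞ e⁻ˣ p(x) dx`. -/
noncomputable def laplace : Polynomial ℚ →ₗ[ℚ] ℚ :=
  Polynomial.lsum fun k => (k ! : ℚ) • LinearMap.id

theorem laplace_monomial (k : ℕ) (c : ℚ) : laplace (Polynomial.monomial k c) = k ! * c := by
  simp [laplace, Polynomial.lsum_apply, Polynomial.sum_monomial_index]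

/-- Integration by parts. -/
theorem laplace_derivative (p : Polynomial ℚ) :
    laplace (Polynomial.derivative p) = laplace p - p.coeff 0 := by
  induction p using Polynomial.induction_on' with
  | add p q hp hq => rw [map_add, map_add, map_add, hp, hq, Polynomial.coeff_add]; ring
  | monomial k c =>
    rw [Polynomial.derivative_monomial, laplace_monomial, laplace_monomial,
      Polynomial.coeff_monomial]
    rcases k with _ | k
    · simp
    · rw [if_neg (by omega), Nat.add_sub_cancel, Nat.factorial_succ]
      push_cast
      ring

/-- Setting `x = 0` in a bivariate series. -/
noncomputable def evalXZero : BivSeries →+* ℚ⟦X⟧ := PowerSeries.map Polynomial.constantCoeff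

theorem coeff_evalXZero (n : ℕ) (F : BivSeries) : coeff n (evalXZero F) = (coeff n F).coeff 0 := by
  simp [evalXZero, Polynomial.constantCoeff_apply]

theorem evalXZero_serS : evalXZero serS = 0 := by
  ext n
  simp [coeff_evalXZero, serS]

theorem evalXZero_twistT (F : BivSeries) : evalXZero (twistT F) = d⁄dX ℚ (evalXZero F) := by
  have h : ∀ F, evalXZero (derivT F) = d⁄dX ℚ (evalXZero F) := fun F => by
    ext n
    have h3 : ((n : Polynomial ℚ) + 1) = Polynomial.C ((n : ℚ) + 1) := by simp
    rw [coeff_evalXZero, coeff_derivT, coeff_derivative, coeff_evalXZero, h3,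
      Polynomial.coeff_mul_C]
  rw [twistT_apply, map_sub, map_mul, h, h, evalXZero_serS, map_zero, zero_mul, sub_zero]

theorem constantCoeff_serJ : constantCoeff serJ = 1 := by
  rw [← coeff_zero_eq_constantCoeff_apply, serJ, coeff_mk]
  simp

theorem constantCoeff_twistX (F : BivSeries) :
    constantCoeff (twistX F) = Polynomial.derivative (constantCoeff F) := by
  rw [twistX_apply, map_add, map_mul, map_sub, map_one, constantCoeff_serJ, sub_self, zero_mul,
    add_zero, ← coeff_zero_eq_constantCoeff_apply, coeff_derivX,
    coeff_zero_eq_constantCoeff_apply]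

/-- The Laplace transform of the value at `t = 0` of the `n`-th twisted `t`-derivative; it is
`n!` times the `n`-th coefficient in `t` of `∫₀^∞ e⁻ˣ exp (x - S) F dx`. -/
noncomputable def laplaceCoeff (n : ℕ) : BivSeries →+ ℚ where
  toFun F := laplace (constantCoeff (twistT^[n] F))
  map_zero' := by simp only [iterate_map_zero, map_zero]
  map_add' F G := by simp only [iterate_map_add, map_add]

theorem laplaceCoeff_apply (n : ℕ) (F : BivSeries) :
    laplaceCoeff n F = laplace (constantCoeff (twistT^[n] F)) := rfl

theorem laplaceCoeff_twistX (n : ℕ) (F : BivSeries) :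
    laplaceCoeff n (twistX F) = laplaceCoeff n F - n ! * coeff n (evalXZero F) := by
  have h1 : twistT^[n] (twistX F) = twistX (twistT^[n] F) :=
    Function.Commute.iterate_left (fun F => (twistX_twistT F).symm) n F
  have h2 : evalXZero (twistT^[n] F) = (d⁄dX ℚ)^[n] (evalXZero F) :=
    Function.Semiconj.iterate_right (f := evalXZero) (ga := twistT) (gb := d⁄dX ℚ)
      evalXZero_twistT n F
  rw [laplaceCoeff_apply, laplaceCoeff_apply, h1, constantCoeff_twistX, laplace_derivative,
    ← constantCoeff_iterate_derivative, ← h2, ← coeff_zero_eq_constantCoeff_apply,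
    ← coeff_zero_eq_constantCoeff_apply, coeff_evalXZero]

theorem laplaceCoeff_X_mul (n : ℕ) (F : BivSeries) :
    laplaceCoeff n (X * F) = n * laplaceCoeff (n - 1) F := by
  have h : twistT^[n] (X * F) = X * twistT^[n] F + n • twistT^[n - 1] F := by
    induction n with
    | zero => simp
    | succ n ih =>
      rw [Function.iterate_succ_apply', ih, map_add, twistT_X_mul,
        ← Function.iterate_succ_apply' twistT, map_nsmul, Nat.add_sub_cancel, add_assoc, add_smul,
        one_smul, add_comm (n • _)]
      rcases n with _ | n
      · simp
      · rw [← Function.iterate_succ_apply' twistT, Nat.add_sub_cancel]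
  rw [laplaceCoeff_apply, h, map_add, map_mul, constantCoeff_X, zero_mul, zero_add, map_nsmul,
    map_nsmul, nsmul_eq_mul, laplaceCoeff_apply]

theorem laplaceCoeff_X_pow_mul (n k : ℕ) (F : BivSeries) :
    laplaceCoeff n (X ^ k * F) = n.descFactorial k * laplaceCoeff (n - k) F := by
  induction k generalizing F with
  | zero => simp
  | succ k ih =>
    rw [pow_succ, mul_assoc, ih, laplaceCoeff_X_mul, Nat.descFactorial_succ, Nat.sub_sub]
    push_cast
    ring

theorem laplaceCoeff_serJ_mul_serS_pow (n k : ℕ) :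
    laplaceCoeff n (serJ * serS ^ k) = if n = 0 then (k ! : ℚ) else 0 := by
  induction k with
  | zero =>
    have h := laplaceCoeff_twistX n 1
    rw [twistX_apply, derivX_one, zero_add, mul_one, map_sub, map_one evalXZero,
      coeff_one] at h
    have h' : laplaceCoeff n serJ = n ! * if n = 0 then 1 else 0 := by linarith
    rw [pow_zero, mul_one, h']
    split_ifs with hn
    · simp [hn]
    · simp
  | succ k ih =>
    have h := laplaceCoeff_twistX n (serS ^ (k + 1))
    rw [twistX_apply, derivX_serS_pow, map_pow evalXZero, evalXZero_serS,
      zero_pow (by omega), map_zero, mul_zero, sub_zero, sub_mul, one_mul, map_add, map_sub,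
      map_nsmul, ih, nsmul_eq_mul] at h
    have h' : laplaceCoeff n (serJ * serS ^ (k + 1)) =
        ((k + 1 : ℕ) : ℚ) * if n = 0 then (k ! : ℚ) else 0 := by linarith
    rw [h', Nat.factorial_succ]
    split_ifs <;> push_cast <;> ring

theorem laplaceCoeff_serJ_mul_X_mul_serS_pow (n k : ℕ) :
    laplaceCoeff n (serJ * (X * serS) ^ k) = if k = n then (n ! * n ! : ℚ) else 0 := by
  rw [mul_pow, mul_left_comm, laplaceCoeff_X_pow_mul, laplaceCoeff_serJ_mul_serS_pow]
  rcases lt_trichotomy k n with h | rfl | h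
  · rw [if_neg (by omega), if_neg (by omega), mul_zero]
  · simp [Nat.descFactorial_self]
  · rw [Nat.descFactorial_of_lt h, if_neg (by omega : ¬ k = n)]
    simp

/-- The substitution `w ↦ x t` of univariate into bivariate series. -/
noncomputable def substXT : ℚ⟦X⟧ →+* BivSeries :=
  (PowerSeries.rescale (Polynomial.X : Polynomial ℚ)).comp (PowerSeries.map Polynomial.C)

theorem coeff_substXT (n : ℕ) (f : ℚ⟦X⟧) :
    coeff n (substXT f) = Polynomial.C (coeff n f) * Polynomial.X ^ n := by
  rw [substXT, RingHom.comp_apply, coeff_rescale, coeff_map, mul_comm]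

theorem substXT_bessel : substXT bessel = X * serS := by
  ext1 n
  rw [coeff_substXT]
  rcases n with _ | n
  · rw [coeff_zero_eq_constantCoeff_apply, constantCoeff_bessel]
    simp
  · rw [coeff_succ_X_mul, coeff_succ_bessel, serS, coeff_mk]

theorem substXT_derivative_bessel : substXT (d⁄dX ℚ bessel) = serJ := by
  ext1 n
  rw [coeff_substXT, coeff_derivative, coeff_succ_bessel, serJ, coeff_mk]
  congr 2
  have h1 : (n ! : ℚ) ≠ 0 := by exact_mod_cast n.factorial_ne_zero
  have h2 : (n : ℚ) + 1 ≠ 0 := by positivity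
  rw [Nat.factorial_succ]
  push_cast
  field_simp

theorem exists_subst_bessel_eq (f : ℚ⟦X⟧) (n : ℕ) :
    ∃ g : ℚ⟦X⟧, f.subst bessel =
      ∑ k ∈ Finset.range (n + 1), coeff k f • bessel ^ k + bessel ^ (n + 1) * g := by
  obtain ⟨q, hq⟩ : (X : ℚ⟦X⟧) ^ (n + 1) ∣ f - (trunc (n + 1) f : Polynomial ℚ) := by
    rw [X_pow_dvd_iff]
    intro m hm
    rw [map_sub, Polynomial.coeff_coe, coeff_trunc, if_pos hm, sub_self]
  refine ⟨q.subst bessel, ?_⟩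
  rw [sub_eq_iff_eq_add'] at hq
  have hs := hasSubst_bessel
  conv_lhs => rw [hq]
  rw [subst_add hs, subst_mul hs, subst_pow hs, subst_X hs, subst_coe hs,
    Polynomial.aeval_eq_sum_range' (natDegree_trunc_lt f n)]
  congr 1
  refine Finset.sum_congr rfl fun k hk => ?_
  rw [coeff_trunc, if_pos (Finset.mem_range.mp hk)]

/-- The Laplace transform of `exp (x - S)` has the coefficients of the inverse Bessel series. Since
`t S` is `bessel` at `x t` and `J` is the derivative of `bessel` there, `1` expands as `J` times the
derivative of the inverse series at `t S`, and only one term of that expansion contributes. -/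
theorem laplaceCoeff_one (n : ℕ) : laplaceCoeff n 1 = besselNumber n := by
  obtain ⟨g, hg⟩ := exists_subst_bessel_eq (d⁄dX ℚ besselInv) n
  have h := congrArg substXT derivative_besselInv_subst
  have hsmul : ∀ (c : ℚ) (f : ℚ⟦X⟧), substXT (c • f) = c • substXT f := fun c f => by
    ext1 m
    simp [coeff_substXT, Polynomial.smul_eq_C_mul, mul_assoc]
  rw [hg, map_mul, map_add, map_sum, map_mul, map_pow, map_one, substXT_derivative_bessel,
    substXT_bessel, mul_comm, mul_add, Finset.mul_sum] at h
  rw [← h, map_add, map_sum]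
  have h0 : laplaceCoeff n (serJ * ((X * serS) ^ (n + 1) * substXT g)) = 0 := by
    rw [mul_pow, show serJ * (X ^ (n + 1) * serS ^ (n + 1) * substXT g) =
      X ^ (n + 1) * (serJ * serS ^ (n + 1) * substXT g) by ring, laplaceCoeff_X_pow_mul,
      Nat.descFactorial_of_lt (Nat.lt_succ_self n)]
    simp
  rw [h0, add_zero]
  have hk : ∀ k, laplaceCoeff n (serJ * substXT (coeff k (d⁄dX ℚ besselInv) • bessel ^ k)) =
      coeff k (d⁄dX ℚ besselInv) * if k = n then (n ! * n ! : ℚ) else 0 := fun k => by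
    rw [hsmul, map_pow, substXT_bessel, mul_smul_comm, map_rat_smul,
      laplaceCoeff_serJ_mul_X_mul_serS_pow, smul_eq_mul]
  rw [Finset.sum_congr rfl fun k _ => hk k, Finset.sum_eq_single n]
  · rw [if_pos rfl, coeff_derivative, besselNumber, Nat.factorial_succ]
    push_cast
    ring
  · intro k _ hkn
    rw [if_neg hkn, mul_zero]
  · simp

end Laplace

/-! ### Series attached to level functions -/

section States

open PowerSeries
open scoped Nat
open Function (update)

/-- The operator attached to a label of level `v`: multiplication by `S` for level one, the twisted
`t`-derivative for level two, and the identity for level zero (and for the values above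
two, which play no role). -/
noncomputable def levelOp (v : ℕ) : BivSeries →+ BivSeries :=
  if v = 1 then AddMonoidHom.mulLeft serS else if v = 2 then twistT else AddMonoidHom.id _

theorem levelOp_one (F : BivSeries) : levelOp 1 F = serS * F := rfl

theorem levelOp_two (F : BivSeries) : levelOp 2 F = twistT F := rfl

theorem levelOp_of_ne {v : ℕ} (h1 : v ≠ 1) (h2 : v ≠ 2) (F : BivSeries) : levelOp v F = F := by
  rw [levelOp, if_neg h1, if_neg h2, AddMonoidHom.id_apply]

/-- The series obtained from `1` by applying the operators of the levels `l 0, …, l (k - 1)`. -/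
noncomputable def stateSeries (l : ℕ → ℕ) : ℕ → BivSeries
  | 0 => 1
  | k + 1 => levelOp (l k) (stateSeries l k)

theorem stateSeries_succ (l : ℕ → ℕ) (k : ℕ) :
    stateSeries l (k + 1) = levelOp (l k) (stateSeries l k) := rfl

theorem stateSeries_congr {l l' : ℕ → ℕ} {k : ℕ} (h : ∀ i < k, l i = l' i) :
    stateSeries l k = stateSeries l' k := by
  induction k with
  | zero => rfl
  | succ k ih =>
    rw [stateSeries_succ, stateSeries_succ, h k (by omega), ih fun i hi => h i (by omega)]

theorem stateSeries_update_self (l : ℕ → ℕ) (k v : ℕ) :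
    stateSeries (update l k v) (k + 1) = levelOp v (stateSeries l k) := by
  rw [stateSeries_succ, Function.update_self]
  congr 1
  exact stateSeries_congr fun i hi => Function.update_of_ne (by omega) _ _

theorem stateSeries_update_of_lt (l : ℕ → ℕ) {i k : ℕ} (v : ℕ) (h : i < k) :
    stateSeries (update l i v) (k + 1) = levelOp (l k) (stateSeries (update l i v) k) := by
  rw [stateSeries_succ, Function.update_of_ne (by omega)]

/-- The sum over the ways to lower one label of level one. -/
noncomputable def sumLowerOne (l : ℕ → ℕ) (k : ℕ) : BivSeries :=
  ∑ i ∈ Finset.range k, if l i = 1 then stateSeries (update l i 0) k else 0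

/-- The sum over the ways to lower one label of level two. -/
noncomputable def sumLowerTwo (l : ℕ → ℕ) (k : ℕ) : BivSeries :=
  ∑ j ∈ Finset.range k, if l j = 2 then stateSeries (update l j 1) k else 0

/-- The sum over the ways to lower simultaneously a label of level one and a larger label of
level two. -/
noncomputable def sumLowerBoth (l : ℕ → ℕ) (k : ℕ) : BivSeries :=
  ∑ j ∈ Finset.range k, ∑ i ∈ Finset.range j,
    if l i = 1 ∧ l j = 2 then stateSeries (update (update l i 0) j 1) k else 0

theorem sumLowerOne_succ (l : ℕ → ℕ) (k : ℕ) :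
    sumLowerOne l (k + 1) =
      levelOp (l k) (sumLowerOne l k) + if l k = 1 then stateSeries l k else 0 := by
  rw [sumLowerOne, Finset.sum_range_succ, sumLowerOne, map_sum, stateSeries_update_self]
  congr 1
  refine Finset.sum_congr rfl fun i hi => ?_
  rw [stateSeries_update_of_lt l 0 (Finset.mem_range.mp hi)]
  split_ifs <;> simp

theorem sumLowerTwo_succ (l : ℕ → ℕ) (k : ℕ) :
    sumLowerTwo l (k + 1) =
      levelOp (l k) (sumLowerTwo l k) + if l k = 2 then serS * stateSeries l k else 0 := by
  rw [sumLowerTwo, Finset.sum_range_succ, sumLowerTwo, map_sum, stateSeries_update_self]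
  congr 1
  refine Finset.sum_congr rfl fun i hi => ?_
  rw [stateSeries_update_of_lt l 1 (Finset.mem_range.mp hi)]
  split_ifs <;> simp

theorem sumLowerBoth_succ (l : ℕ → ℕ) (k : ℕ) :
    sumLowerBoth l (k + 1) =
      levelOp (l k) (sumLowerBoth l k) + if l k = 2 then serS * sumLowerOne l k else 0 := by
  rw [sumLowerBoth, Finset.sum_range_succ, sumLowerBoth, map_sum]
  congr 1
  · refine Finset.sum_congr rfl fun j hj => ?_
    rw [map_sum]
    refine Finset.sum_congr rfl fun i hi => ?_
    have hj := Finset.mem_range.mp hj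
    have hi := Finset.mem_range.mp hi
    rw [stateSeries_succ, Function.update_of_ne (by omega), Function.update_of_ne (by omega)]
    split_ifs <;> simp
  · split_ifs with h
    · rw [sumLowerOne, Finset.mul_sum]
      refine Finset.sum_congr rfl fun i hi => ?_
      rw [stateSeries_update_self, levelOp_one]
      simp [h]
    · simp [h]

/-- The `x`-derivative of the series of a state in terms of the states below it. Moving `J` to the
left through a twisted `t`-derivative produces `S`, which is the reason for the sums over labels of
level two. -/
theorem twistX_stateSeries (l : ℕ → ℕ) (k : ℕ) :
    twistX (stateSeries l k) = serJ * sumLowerOne l k - sumLowerBoth l k +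
      (stateSeries l k - serJ * stateSeries l k) + sumLowerTwo l k := by
  induction k with
  | zero =>
    simp [sumLowerOne, sumLowerTwo, sumLowerBoth, stateSeries, twistX_apply, derivX_one]
  | succ k ih =>
    rw [sumLowerOne_succ, sumLowerTwo_succ, sumLowerBoth_succ, stateSeries_succ]
    by_cases h1 : l k = 1
    · rw [h1]
      simp only [levelOp_one, twistX_serS_mul, ih, if_true, if_neg (by norm_num : ¬ 1 = 2)]
      ring
    by_cases h2 : l k = 2
    · rw [h2]
      simp only [levelOp_two, twistX_twistT, ih, if_true, if_neg (by norm_num : ¬ 2 = 1)]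
      rw [map_add, map_add, map_sub, map_sub, twistT_serJ_mul, twistT_serJ_mul]
      ring
    · simp only [levelOp_of_ne h1 h2, ih, if_neg h1, if_neg h2, add_zero]

theorem stateSeries_of_eq_zero {l : ℕ → ℕ} {k : ℕ} (h : ∀ i < k, l i = 0) :
    stateSeries l k = 1 := by
  induction k with
  | zero => rfl
  | succ k ih =>
    rw [stateSeries_succ, h k (by omega), levelOp_of_ne (by omega) (by omega),
      ih fun i hi => h i (by omega)]

theorem evalXZero_stateSeries_of_ne_zero {l : ℕ → ℕ} (hl : ∀ i, l i ≤ 2) {k : ℕ}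
    (h : ∃ i < k, l i ≠ 0) : evalXZero (stateSeries l k) = 0 := by
  induction k with
  | zero => obtain ⟨i, hi, _⟩ := h; omega
  | succ k ih =>
    rw [stateSeries_succ]
    by_cases hk : ∃ i < k, l i ≠ 0
    · have ih := ih hk
      by_cases h1 : l k = 1
      · rw [h1, levelOp_one, map_mul, ih, mul_zero]
      by_cases h2 : l k = 2
      · rw [h2, levelOp_two, evalXZero_twistT, ih, map_zero]
      · rw [levelOp_of_ne h1 h2, ih]
    · push Not at hk
      rw [stateSeries_of_eq_zero hk]
      obtain ⟨i, hi, hi0⟩ := h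
      have hik : i = k := by
        by_contra hne
        exact hi0 (hk i (by omega))
      subst hik
      have h2 := hl i
      obtain h | h : l i = 1 ∨ l i = 2 := by omega
      · rw [h, levelOp_one, map_mul, evalXZero_serS, zero_mul]
      · rw [h, levelOp_two, evalXZero_twistT, map_one, derivative_one]

/-- The Laplace transform of the series of a state at `t = 0`; it turns out to be the number of
tilings of the shape of that state. -/
noncomputable def stateCount (n : ℕ) (l : ℕ → ℕ) : ℚ := laplace (constantCoeff (stateSeries l n))

theorem stateCount_of_eq_zero {n : ℕ} {l : ℕ → ℕ} (h : ∀ i < n, l i = 0) : stateCount n l = 1 := by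
  rw [stateCount, stateSeries_of_eq_zero h, map_one, ← Polynomial.monomial_zero_one,
    laplace_monomial]
  simp

theorem stateCount_two (n : ℕ) : stateCount n (fun _ => 2) = besselNumber n := by
  have h : stateSeries (fun _ => 2) n = twistT^[n] 1 := by
    induction n with
    | zero => rfl
    | succ n ih => rw [stateSeries_succ, levelOp_two, ih, Function.iterate_succ_apply']
  rw [stateCount, h, ← laplaceCoeff_apply, laplaceCoeff_one]

/-- The recursion for `stateCount`, by integration by parts: the boundary term is the value at
`x = 0`, which vanishes unless all levels are zero. -/
theorem stateCount_rec {n : ℕ} {l : ℕ → ℕ} (hl : ∀ i, l i ≤ 2) (h : ∃ i < n, l i ≠ 0) :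
    stateCount n l =
      (∑ i ∈ Finset.range n, if l i = 1 then stateCount n (update l i 0) else 0) +
      (∑ j ∈ Finset.range n, if l j = 2 then stateCount n (update l j 1) else 0) -
      ∑ j ∈ Finset.range n, ∑ i ∈ Finset.range j,
        if l i = 1 ∧ l j = 2 then stateCount n (update (update l i 0) j 1) else 0 := by
  have h0 : (constantCoeff (stateSeries l n)).coeff 0 = 0 := by
    rw [← coeff_zero_eq_constantCoeff_apply, ← coeff_evalXZero,
      evalXZero_stateSeries_of_ne_zero hl h, map_zero]
  have h1 : stateCount n l = laplace (constantCoeff (twistX (stateSeries l n))) := by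
    rw [constantCoeff_twistX, laplace_derivative, h0, sub_zero, stateCount]
  have h2 : ∀ (p : Prop) [Decidable p] (F : BivSeries),
      laplace (constantCoeff (if p then F else 0)) =
        if p then laplace (constantCoeff F) else 0 := by
    intro p _ F
    split_ifs <;> simp
  rw [h1, twistX_stateSeries]
  simp only [map_add, map_sub, map_mul, constantCoeff_serJ, one_mul, sub_self, add_zero,
    sumLowerOne, sumLowerTwo, sumLowerBoth, map_sum, h2, stateCount]
  ring

end States

/-! ### Border-strips and removable parts -/

section Strips

/-- The index `row - column` of the diagonal of a box. -/
def diag (x : ℕ × ℕ) : ℤ := (x.1 : ℤ) - x.2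

theorem isLowerSet_of_pred {s : Set (ℕ × ℕ)} (h1 : ∀ i j, (i + 1, j) ∈ s → (i, j) ∈ s)
    (h2 : ∀ i j, (i, j + 1) ∈ s → (i, j) ∈ s) : IsLowerSet s := by
  rintro ⟨a, b⟩ ⟨c, d⟩ ⟨hca, hdb⟩ hab
  obtain ⟨k, rfl⟩ : ∃ k, a = c + k := Nat.exists_eq_add_of_le hca
  obtain ⟨m, rfl⟩ : ∃ m, b = d + m := Nat.exists_eq_add_of_le hdb
  have hk : ∀ k, (c + k, d + m) ∈ s → (c, d + m) ∈ s := by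
    intro k
    induction k with
    | zero => exact id
    | succ k ih => exact fun h => ih (h1 _ _ h)
  have hm : ∀ m, (c, d + m) ∈ s → (c, d) ∈ s := by
    intro m
    induction m with
    | zero => exact id
    | succ m ih => exact fun h => ih (h2 _ _ h)
  exact hm m (hk k hab)

theorem boxGraph_adj_iff {x y : ℕ × ℕ} : boxGraph.Adj x y ↔
    ((x.1 + 1 = y.1 ∨ y.1 + 1 = x.1) ∧ x.2 = y.2) ∨
      ((x.2 + 1 = y.2 ∨ y.2 + 1 = x.2) ∧ x.1 = y.1) := by
  simp [boxGraph, SimpleGraph.boxProd_adj, SimpleGraph.hasse_adj, Nat.covBy_iff_add_one_eq]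

theorem _root_.IsBorderStrip.mem_of_le_of_le {B : Finset (ℕ × ℕ)} (hB : IsBorderStrip B)
    {x y z : ℕ × ℕ} (hx : x ∈ B) (hz : z ∈ B) (hxy : x ≤ y) (hyz : y ≤ z) : y ∈ B := by
  obtain ⟨lam, mu, -, rfl⟩ := hB.1
  rw [Finset.mem_sdiff] at hx hz ⊢
  exact ⟨lam.isLowerSet hyz hz.1, fun hy => hx.2 (mu.isLowerSet hxy hy)⟩

theorem _root_.IsBorderStrip.eq_of_diag_eq {B : Finset (ℕ × ℕ)} (hB : IsBorderStrip B)
    {x y : ℕ × ℕ} (hx : x ∈ B) (hy : y ∈ B) (h : diag x = diag y) : x = y := by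
  wlog hlt : x.1 ≤ y.1 generalizing x y
  · exact (this hy hx h.symm (by omega)).symm
  simp only [diag] at h
  by_contra hne
  have hlt' : x.1 < y.1 := by
    refine lt_of_le_of_ne hlt fun h1 => hne (Prod.ext h1 ?_)
    omega
  refine hB.2.2 x.1 x.2 fun z hz => ?_
  simp only [Finset.mem_insert, Finset.mem_singleton] at hz
  refine hB.mem_of_le_of_le hx hy ?_ ?_ <;> rcases hz with rfl | rfl | rfl | rfl <;>
    rw [Prod.le_def] <;> constructor <;> dsimp only <;> omega

/-- A border-strip that meets a diagonal before that of `z ∈ B` contains a neighbour of `z` on the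
diagonal just before. -/
theorem _root_.IsBorderStrip.exists_mem_diag_eq_sub_one {B : Finset (ℕ × ℕ)}
    (hB : IsBorderStrip B) {w z : ℕ × ℕ} (hw : w ∈ B) (hz : z ∈ B) (h : diag w < diag z) :
    (z.1, z.2 + 1) ∈ B ∨ ∃ i, z.1 = i + 1 ∧ (i, z.2) ∈ B := by
  have key : ∀ (a b : (B : Set (ℕ × ℕ))) (_ : (boxGraph.induce (B : Set (ℕ × ℕ))).Walk a b),
      diag b < diag z → diag z ≤ diag a →
      ∃ u v : (B : Set (ℕ × ℕ)), boxGraph.Adj u v ∧ diag u = diag z ∧ diag v < diag z := by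
    intro a b p
    induction p with
    | nil => intro h1 h2; omega
    | @cons a c b hac p ih =>
      intro h1 h2
      by_cases h3 : diag z ≤ diag c
      · exact ih h1 h3
      · have hadj : boxGraph.Adj (a : ℕ × ℕ) c := hac
        refine ⟨a, c, hadj, ?_, by omega⟩
        rw [boxGraph_adj_iff] at hadj
        simp only [diag] at h2 h3 ⊢
        omega
  obtain ⟨p⟩ := hB.2.1.preconnected ⟨z, hz⟩ ⟨w, hw⟩
  obtain ⟨u, v, hadj, hu, hv⟩ := key _ _ p h le_rfl
  have huz : (u : ℕ × ℕ) = z := hB.eq_of_diag_eq u.2 hz hu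
  have hvB : (v : ℕ × ℕ) ∈ B := v.2
  rw [huz, boxGraph_adj_iff] at hadj
  simp only [diag] at hv
  rcases hadj with ⟨h1, h2⟩ | ⟨h1, h2⟩
  · refine Or.inr ⟨(v : ℕ × ℕ).1, by omega, ?_⟩
    rw [h2]
    exact hvB
  · refine Or.inl ?_
    have : ((z.1, z.2 + 1) : ℕ × ℕ) = v := Prod.ext h2 (by dsimp only; omega)
    rw [this]
    exact hvB

/-- `P` is the set of parts of a partition of `D` into border-strips with `n` boxes each. -/
structure IsStripTiling (n : ℕ) (D : Finset (ℕ × ℕ)) (P : Finset (Finset (ℕ × ℕ))) : Prop where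
  isBorderStrip : ∀ B ∈ P, IsBorderStrip B
  card_eq : ∀ B ∈ P, B.card = n
  eq_of_mem : ∀ B ∈ P, ∀ C ∈ P, ∀ x, x ∈ B → x ∈ C → B = C
  mem_iff : ∀ x, x ∈ D ↔ ∃ B ∈ P, x ∈ B

theorem IsStripTiling.subset {n : ℕ} {D : Finset (ℕ × ℕ)} {P : Finset (Finset (ℕ × ℕ))}
    (hP : IsStripTiling n D P) {B : Finset (ℕ × ℕ)} (hB : B ∈ P) : B ⊆ D :=
  fun x hx => (hP.mem_iff x).mpr ⟨B, hB, hx⟩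

/-- Every tiling of a nonempty diagram by border-strips has a part whose removal leaves a diagram.
Such a part is found among the parts `B` whose box `x` on their first diagonal has no box of the
diagram to its right: if the first diagonal of `B` is the latest possible, then `B` is removable,
because the first box of `B` with a successor outside `B` would give a part starting later. -/
theorem IsStripTiling.exists_isLowerSet_sdiff {n : ℕ} {D : Finset (ℕ × ℕ)}
    {P : Finset (Finset (ℕ × ℕ))} (hP : IsStripTiling n D P)
    (hD : IsLowerSet (D : Set (ℕ × ℕ))) (hne : D.Nonempty) :
    ∃ B ∈ P, IsLowerSet ((D \ B : Finset (ℕ × ℕ)) : Set (ℕ × ℕ)) := by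
  classical
  let good : ℕ × ℕ → Prop := fun x =>
    (x.1, x.2 + 1) ∉ D ∧ ∀ B ∈ P, x ∈ B → ∀ y ∈ B, diag x ≤ diag y
  have hgood : (D.filter good).Nonempty := by
    obtain ⟨x, hx, hmin⟩ := D.exists_min_image diag hne
    refine ⟨x, Finset.mem_filter.mpr ⟨hx, fun h => ?_, fun B hB _ y hy =>
      hmin y (hP.subset hB hy)⟩⟩
    have := hmin _ h
    simp only [diag] at this
    push_cast at this
    omega
  obtain ⟨x, hx, hmax⟩ := (D.filter good).exists_max_image diag hgood
  obtain ⟨hxD, hx1, hx2⟩ := Finset.mem_filter.mp hx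
  obtain ⟨B, hBP, hxB⟩ := (hP.mem_iff x).mp hxD
  have hB := hP.isBorderStrip B hBP
  refine ⟨B, hBP, ?_⟩
  let bad : ℕ × ℕ → Prop := fun y =>
    ((y.1 + 1, y.2) ∈ D ∧ (y.1 + 1, y.2) ∉ B) ∨ ((y.1, y.2 + 1) ∈ D ∧ (y.1, y.2 + 1) ∉ B)
  by_cases hbad : (B.filter bad).Nonempty
  swap
  · rw [Finset.not_nonempty_iff_eq_empty, Finset.filter_eq_empty_iff] at hbad
    refine isLowerSet_of_pred (fun i j h => ?_) (fun i j h => ?_)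
    · rw [Finset.mem_coe, Finset.mem_sdiff] at h ⊢
      refine ⟨hD (Prod.mk_le_mk.mpr ⟨Nat.le_succ i, le_rfl⟩) h.1, fun hB => hbad hB (Or.inl h)⟩
    · rw [Finset.mem_coe, Finset.mem_sdiff] at h ⊢
      refine ⟨hD (Prod.mk_le_mk.mpr ⟨le_rfl, Nat.le_succ j⟩) h.1, fun hB => hbad hB (Or.inr h)⟩
  exfalso
  obtain ⟨y, hy, hmin⟩ := (B.filter bad).exists_min_image diag hbad
  obtain ⟨hyB, hybad⟩ := Finset.mem_filter.mp hy
  have hdown : ∀ w ∈ B, diag w < diag y → (w.1 + 1, w.2) ∈ D → (w.1 + 1, w.2) ∈ B := by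
    intro w hw hlt hwD
    by_contra hwB
    exact absurd (hmin w (Finset.mem_filter.mpr ⟨hw, Or.inl ⟨hwD, hwB⟩⟩)) (not_le.mpr hlt)
  have hright : ∀ w ∈ B, diag w < diag y → (w.1, w.2 + 1) ∈ D → (w.1, w.2 + 1) ∈ B := by
    intro w hw hlt hwD
    by_contra hwB
    exact absurd (hmin w (Finset.mem_filter.mpr ⟨hw, Or.inr ⟨hwD, hwB⟩⟩)) (not_le.mpr hlt)
  have hxy : diag x ≤ diag y := hx2 B hBP hxB y hyB
  by_cases hr : (y.1, y.2 + 1) ∈ D ∧ (y.1, y.2 + 1) ∉ B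
  · -- The right neighbour of `y` cannot lie outside `B`: the box of `B` before `y` would be above
    -- `y`, and walking around the resulting square shows that the neighbour lies in `B`.
    rcases eq_or_lt_of_le hxy with heq | hlt
    · exact hx1 (hB.eq_of_diag_eq hxB hyB heq ▸ hr.1)
    rcases hB.exists_mem_diag_eq_sub_one hxB hyB hlt with h | ⟨i, hi, h⟩
    · exact hr.2 h
    · have h1 : (i, y.2 + 1) ∈ B := by
        refine hright (i, y.2) h ?_ (hD (Prod.mk_le_mk.mpr ⟨?_, le_rfl⟩) hr.1)
        · simp only [diag]
          omega
        · omega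
      have h2 : (i + 1, y.2 + 1) ∈ B := by
        refine hdown (i, y.2 + 1) h1 ?_ (hi ▸ hr.1)
        simp only [diag]
        push_cast
        omega
      exact hr.2 (hi ▸ h2)
  · -- The part containing the lower neighbour of `y` starts there, on a diagonal later than `x`.
    have hz : (y.1 + 1, y.2) ∈ D ∧ (y.1 + 1, y.2) ∉ B := hybad.resolve_right hr
    have hr' : (y.1, y.2 + 1) ∈ D → (y.1, y.2 + 1) ∈ B := fun h => by
      by_contra hB'
      exact hr ⟨h, hB'⟩
    have hz1 : (y.1 + 1, y.2 + 1) ∉ D := by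
      intro h
      have h1 : (y.1, y.2 + 1) ∈ B :=
        hr' (hD (Prod.mk_le_mk.mpr ⟨Nat.le_succ _, le_rfl⟩) h)
      have h2 : (y.1 + 1, y.2 + 1) ∈ B := by
        refine hdown (y.1, y.2 + 1) h1 ?_ h
        simp only [diag]
        push_cast
        omega
      refine hz.2 (hB.mem_of_le_of_le hyB h2 ?_ ?_) <;> rw [Prod.le_def] <;> constructor <;>
        dsimp only <;> omega
    have hzgood : good (y.1 + 1, y.2) := by
      refine ⟨hz1, fun C hC hzC w hw => ?_⟩
      by_contra hlt
      rcases (hP.isBorderStrip C hC).exists_mem_diag_eq_sub_one hw hzC (not_le.mp hlt) with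
        h | ⟨i, hi, h⟩
      · exact hz1 (hP.subset hC h)
      · have hi : y.1 = i := by
          dsimp only at hi
          omega
        subst hi
        exact hz.2 (hP.eq_of_mem B hBP C hC y hyB h ▸ hzC)
    have h := hmax _ (Finset.mem_filter.mpr ⟨hz.1, hzgood⟩)
    simp only [diag] at h hxy
    push_cast at h
    omega

end Strips

/-! ### Diagrams given by beads -/

section Beads

/-- The number of beads of `X` at positions above `k`. -/
def beadsAbove (X : Finset ℕ) (k : ℕ) : ℕ := (X.filter (k < ·)).card

theorem beadsAbove_le_card (X : Finset ℕ) (k : ℕ) : beadsAbove X k ≤ X.card :=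
  Finset.card_filter_le _ _

theorem beadsAbove_insert {X : Finset ℕ} {b : ℕ} (h : b ∉ X) (k : ℕ) :
    beadsAbove (insert b X) k = beadsAbove X k + if k < b then 1 else 0 := by
  rw [beadsAbove, Finset.filter_insert]
  split_ifs with hk
  · rw [Finset.card_insert_of_notMem (fun hb => h (Finset.mem_filter.mp hb).1), beadsAbove]
  · rfl

theorem beadsAbove_eq_succ_add (X : Finset ℕ) (k : ℕ) :
    beadsAbove X k = beadsAbove X (k + 1) + if k + 1 ∈ X then 1 else 0 := by
  by_cases h : k + 1 ∈ X
  · have h1 : X.filter (k < ·) = insert (k + 1) (X.filter (k + 1 < ·)) := by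
      ext b
      simp only [Finset.mem_filter, Finset.mem_insert]
      constructor
      · rintro ⟨hb, hk⟩
        by_cases hbk : b = k + 1
        · exact Or.inl hbk
        · exact Or.inr ⟨hb, by omega⟩
      · rintro (rfl | ⟨hb, hk⟩)
        · exact ⟨h, by omega⟩
        · exact ⟨hb, by omega⟩
    rw [if_pos h, beadsAbove, h1, Finset.card_insert_of_notMem (by simp), beadsAbove]
  · rw [if_neg h, beadsAbove, beadsAbove, add_zero]
    congr 1
    refine Finset.filter_congr fun b hb => ?_
    have : b ≠ k + 1 := fun e => h (e ▸ hb)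
    omega

theorem card_le_beadsAbove_add (X : Finset ℕ) (k : ℕ) : X.card ≤ beadsAbove X k + (k + 1) := by
  have h1 := Finset.card_filter_add_card_filter_not (s := X) (k < ·)
  have h2 : (X.filter fun b => ¬ k < b).card ≤ k + 1 := by
    rw [← Finset.card_range (k + 1)]
    refine Finset.card_le_card fun b hb => ?_
    have := (Finset.mem_filter.mp hb).2
    rw [Finset.mem_range]
    omega
  rw [beadsAbove]
  omega

theorem beadsAbove_zero_lt {X : Finset ℕ} (h : 0 ∈ X) : beadsAbove X 0 < X.card := by
  refine Finset.card_lt_card ((Finset.filter_ssubset).mpr ⟨0, h, by simp⟩)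

/-- The diagonal of a box in a diagram with `n` columns, counted from the upper right corner. -/
def diagIndex (n : ℕ) (x : ℕ × ℕ) : ℕ := x.1 + (n - 1 - x.2)

/-- The diagram with `n` columns whose boundary path, followed from the upper right corner, has its
horizontal steps at the beads of `X`: a box belongs to it if the number of beads beyond its diagonal
exceeds its column. -/
def shape (n : ℕ) (X : Finset ℕ) : Finset (ℕ × ℕ) :=
  (Finset.range (X.sup id + 1) ×ˢ Finset.range n).filter
    fun x => x.2 < beadsAbove X (diagIndex n x)

theorem mem_shape {n : ℕ} {X : Finset ℕ} {x : ℕ × ℕ} :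
    x ∈ shape n X ↔ x.2 < n ∧ x.2 < beadsAbove X (diagIndex n x) := by
  simp only [shape, Finset.mem_filter, Finset.mem_product, Finset.mem_range]
  refine ⟨fun h => ⟨h.1.2, h.2⟩, fun h => ⟨⟨?_, h.1⟩, h.2⟩⟩
  obtain ⟨b, hb⟩ := Finset.card_pos.mp (lt_of_le_of_lt (Nat.zero_le _) h.2)
  obtain ⟨hb, hlt⟩ := Finset.mem_filter.mp hb
  have : b ≤ X.sup id := Finset.le_sup (f := id) hb
  rw [diagIndex] at hlt
  omega

theorem isLowerSet_shape (n : ℕ) (X : Finset ℕ) : IsLowerSet (shape n X : Set (ℕ × ℕ)) := by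
  refine isLowerSet_of_pred (fun i j h => ?_) (fun i j h => ?_) <;>
    rw [Finset.mem_coe, mem_shape] at h ⊢ <;> simp only [diagIndex] at h ⊢
  · have h1 := beadsAbove_eq_succ_add X (i + (n - 1 - j))
    rw [show i + 1 + (n - 1 - j) = i + (n - 1 - j) + 1 by omega] at h
    omega
  · have h1 := beadsAbove_eq_succ_add X (i + (n - 1 - (j + 1)))
    rw [show i + (n - 1 - (j + 1)) + 1 = i + (n - 1 - j) by omega] at h1
    split_ifs at h1 <;> omega

/-- The bead set obtained by moving the bead at `p + n` to `p`. -/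
def moveBead (n : ℕ) (X : Finset ℕ) (p : ℕ) : Finset ℕ := insert p (X.erase (p + n))

theorem card_moveBead {n : ℕ} {X : Finset ℕ} {p : ℕ} (h1 : p ∉ X) (h2 : p + n ∈ X) :
    (moveBead n X p).card = X.card := by
  rw [moveBead, Finset.card_insert_of_notMem (fun h => h1 (Finset.mem_of_mem_erase h)),
    Finset.card_erase_add_one h2]

theorem beadsAbove_moveBead {n : ℕ} {X : Finset ℕ} {p : ℕ} (h1 : p ∉ X) (h2 : p + n ∈ X) (k : ℕ) :
    beadsAbove X k =
      beadsAbove (moveBead n X p) k + if p ≤ k ∧ k < p + n then 1 else 0 := by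
  have h3 : beadsAbove X k = beadsAbove (X.erase (p + n)) k + if k < p + n then 1 else 0 := by
    rw [← beadsAbove_insert (Finset.notMem_erase _ _), Finset.insert_erase h2]
  rw [h3, moveBead, beadsAbove_insert fun h => h1 (Finset.mem_of_mem_erase h)]
  split_ifs <;> omega

/-- The last box of the diagram of `X` on the `k`-th diagonal. This is meaningful only if the
diagonal meets the diagram, otherwise the subtractions are truncated. -/
def rimBox (n : ℕ) (X : Finset ℕ) (k : ℕ) : ℕ × ℕ :=
  (k - (n - beadsAbove X k), beadsAbove X k - 1)

/-- The `n` consecutive boxes of the rim of the diagram of `X` that start on the `p`-th diagonal. -/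
def rimStrip (n : ℕ) (X : Finset ℕ) (p : ℕ) : Finset (ℕ × ℕ) :=
  (Finset.Ico p (p + n)).image (rimBox n X)

section Removable

variable {n : ℕ} {X : Finset ℕ} {p : ℕ}

theorem beadsAbove_pos_of_mem_Ico (h2 : p + n ∈ X) {k : ℕ} (hk : k ∈ Finset.Ico p (p + n)) :
    0 < beadsAbove X k :=
  Finset.card_pos.mpr ⟨p + n, Finset.mem_filter.mpr ⟨h2, (Finset.mem_Ico.mp hk).2⟩⟩

theorem le_beadsAbove_add_of_mem_Ico (hX : X.card = n) (h1 : p ∉ X) (h2 : p + n ∈ X) {k : ℕ}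
    (hk : k ∈ Finset.Ico p (p + n)) : n ≤ beadsAbove X k + k := by
  have h3 := beadsAbove_moveBead h1 h2 k
  rw [if_pos (Finset.mem_Ico.mp hk)] at h3
  have h4 := card_le_beadsAbove_add (moveBead n X p) k
  rw [card_moveBead h1 h2] at h4
  omega

theorem diagIndex_rimBox (hX : X.card = n) (h1 : p ∉ X) (h2 : p + n ∈ X) {k : ℕ}
    (hk : k ∈ Finset.Ico p (p + n)) : diagIndex n (rimBox n X k) = k := by
  have h3 := beadsAbove_pos_of_mem_Ico h2 hk
  have h4 := le_beadsAbove_add_of_mem_Ico hX h1 h2 hk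
  have h5 := beadsAbove_le_card X k
  simp only [diagIndex, rimBox]
  omega

theorem shape_sdiff_shape_moveBead (hX : X.card = n) (h1 : p ∉ X) (h2 : p + n ∈ X) :
    shape n X \ shape n (moveBead n X p) = rimStrip n X p := by
  ext x
  rw [Finset.mem_sdiff, mem_shape, mem_shape, rimStrip, Finset.mem_image]
  have h3 := beadsAbove_moveBead h1 h2 (diagIndex n x)
  constructor
  · rintro ⟨⟨h4, h5⟩, h6⟩
    have h7 : p ≤ diagIndex n x ∧ diagIndex n x < p + n := by
      by_contra h
      rw [if_neg h] at h3
      exact h6 ⟨h4, by omega⟩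
    rw [if_pos h7] at h3
    have h8 : beadsAbove X (diagIndex n x) = x.2 + 1 := by
      by_contra h
      exact h6 ⟨h4, by omega⟩
    refine ⟨diagIndex n x, Finset.mem_Ico.mpr h7, ?_⟩
    rw [rimBox, h8]
    refine Prod.ext ?_ ?_
    · simp only [diagIndex]
      omega
    · simp
  · rintro ⟨k, hk, rfl⟩
    rw [diagIndex_rimBox hX h1 h2 hk] at h3 ⊢
    rw [if_pos (Finset.mem_Ico.mp hk)] at h3
    have h5 := beadsAbove_le_card X k
    simp only [rimBox]
    omega

theorem shape_moveBead_subset (h1 : p ∉ X) (h2 : p + n ∈ X) :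
    shape n (moveBead n X p) ⊆ shape n X := by
  intro x
  rw [mem_shape, mem_shape]
  have h3 := beadsAbove_moveBead h1 h2 (diagIndex n x)
  omega

theorem rimStrip_subset_shape (hX : X.card = n) (h1 : p ∉ X) (h2 : p + n ∈ X) :
    rimStrip n X p ⊆ shape n X := by
  rw [← shape_sdiff_shape_moveBead hX h1 h2]
  exact Finset.sdiff_subset

theorem shape_sdiff_rimStrip (hX : X.card = n) (h1 : p ∉ X) (h2 : p + n ∈ X) :
    shape n X \ rimStrip n X p = shape n (moveBead n X p) := by
  rw [← shape_sdiff_shape_moveBead hX h1 h2,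
    Finset.sdiff_sdiff_eq_self (shape_moveBead_subset h1 h2)]

theorem card_rimStrip (hX : X.card = n) (h1 : p ∉ X) (h2 : p + n ∈ X) :
    (rimStrip n X p).card = n := by
  rw [rimStrip, Finset.card_image_of_injOn, Nat.card_Ico, Nat.add_sub_cancel_left]
  intro a ha b hb hab
  rw [← diagIndex_rimBox hX h1 h2 ha, ← diagIndex_rimBox hX h1 h2 hb, hab]

theorem boxGraph_adj_rimBox (hX : X.card = n) (h1 : p ∉ X) (h2 : p + n ∈ X) {k : ℕ}
    (hk : k ∈ Finset.Ico p (p + n)) (hk' : k + 1 ∈ Finset.Ico p (p + n)) :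
    boxGraph.Adj (rimBox n X k) (rimBox n X (k + 1)) := by
  have h3 := beadsAbove_pos_of_mem_Ico h2 hk
  have h3' := beadsAbove_pos_of_mem_Ico h2 hk'
  have h4 := le_beadsAbove_add_of_mem_Ico hX h1 h2 hk
  have h5 := beadsAbove_le_card X k
  have h6 := beadsAbove_eq_succ_add X k
  rw [boxGraph_adj_iff]
  simp only [rimBox]
  split_ifs at h6 <;> omega

theorem isBorderStrip_rimStrip (hn : 0 < n) (hX : X.card = n) (h1 : p ∉ X) (h2 : p + n ∈ X) :
    IsBorderStrip (rimStrip n X p) := by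
  refine ⟨⟨⟨shape n X, isLowerSet_shape n X⟩,
    ⟨shape n (moveBead n X p), isLowerSet_shape n _⟩, shape_moveBead_subset h1 h2,
    (shape_sdiff_shape_moveBead hX h1 h2).symm⟩, ?_, ?_⟩
  · have hmem : ∀ k, k < n → rimBox n X (p + k) ∈ (rimStrip n X p : Set (ℕ × ℕ)) := fun k hk =>
      Finset.mem_coe.mpr (Finset.mem_image_of_mem _ (Finset.mem_Ico.mpr ⟨by omega, by omega⟩))
    have hreach : ∀ k (hk : k < n), (boxGraph.induce (rimStrip n X p : Set (ℕ × ℕ))).Reachable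
        ⟨rimBox n X (p + 0), hmem 0 hn⟩ ⟨rimBox n X (p + k), hmem k hk⟩ := by
      intro k
      induction k with
      | zero => exact fun _ => SimpleGraph.Reachable.refl _
      | succ k ih =>
        intro hk
        refine (ih (by omega)).trans (SimpleGraph.Adj.reachable ?_)
        exact boxGraph_adj_rimBox hX h1 h2 (k := p + k) (Finset.mem_Ico.mpr ⟨by omega, by omega⟩)
          (Finset.mem_Ico.mpr ⟨by omega, by omega⟩)
    rw [SimpleGraph.connected_iff_exists_forall_reachable]
    refine ⟨⟨rimBox n X (p + 0), hmem 0 hn⟩, ?_⟩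
    rintro ⟨x, hx⟩
    obtain ⟨k, hk, rfl⟩ := Finset.mem_image.mp (Finset.mem_coe.mp hx)
    obtain ⟨hk1, hk2⟩ := Finset.mem_Ico.mp hk
    obtain ⟨m, rfl⟩ := Nat.exists_eq_add_of_le hk1
    exact hreach m (by omega)
  · intro i j h
    have ha : (i, j) ∈ rimStrip n X p := h (by simp)
    have hb : (i + 1, j + 1) ∈ rimStrip n X p := h (by simp)
    have hb' := (mem_shape.mp (rimStrip_subset_shape hX h1 h2 hb)).1
    obtain ⟨k, hk, hka⟩ := Finset.mem_image.mp ha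
    obtain ⟨m, hm, hmb⟩ := Finset.mem_image.mp hb
    have h3 := diagIndex_rimBox hX h1 h2 hk
    have h4 := diagIndex_rimBox hX h1 h2 hm
    rw [hka] at h3
    rw [hmb] at h4
    simp only [diagIndex] at h3 h4 hb'
    have hkm : k = m := by omega
    rw [hkm, hmb] at hka
    simp at hka

theorem eq_Ico_of_card_eq {s : Finset ℕ} (hs : s.card = n) (hmin : ∀ k ∈ s, p ≤ k)
    (hpred : ∀ k ∈ s, p < k → k - 1 ∈ s) : s = Finset.Ico p (p + n) := by
  have hsub : s ⊆ Finset.Ico p (p + n) := by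
    intro k hk
    have h1 : Finset.Icc p k ⊆ s := by
      intro m hm
      obtain ⟨h1, h2⟩ := Finset.mem_Icc.mp hm
      obtain ⟨d, rfl⟩ := Nat.exists_eq_add_of_le h2
      clear hm h2
      induction d with
      | zero => exact hk
      | succ d ih => exact ih (hpred _ hk (by omega))
    have h2 := Finset.card_le_card h1
    rw [Nat.card_Icc, hs] at h2
    have h3 := hmin k hk
    rw [Finset.mem_Ico]
    omega
  refine Finset.eq_of_subset_of_card_le hsub ?_
  rw [Nat.card_Ico, hs]
  omega

/-- A removable border-strip with `n` boxes is a strip of the rim that belongs to a bead which can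
be moved down by `n`. -/
theorem exists_eq_rimStrip (hn : 0 < n) (hX : X.card = n) {B : Finset (ℕ × ℕ)}
    (hB : IsBorderStrip B) (hcard : B.card = n) (hsub : B ⊆ shape n X)
    (hlow : IsLowerSet ((shape n X \ B : Finset (ℕ × ℕ)) : Set (ℕ × ℕ))) :
    ∃ p, p ∉ X ∧ p + n ∈ X ∧ B = rimStrip n X p := by
  have hmem : ∀ x ∈ B, x.2 < n ∧ x.2 < beadsAbove X (diagIndex n x) := fun x hx =>
    mem_shape.mp (hsub hx)
  have hdiag : ∀ x ∈ B, (diagIndex n x : ℤ) = diag x + (n - 1) := by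
    intro x hx
    have := (hmem x hx).1
    simp only [diagIndex, diag]
    omega
  have hclosed : ∀ x ∈ B, ∀ y ∈ shape n X, x ≤ y → y ∈ B := by
    intro x hx y hy hxy
    by_contra hyB
    have h := hlow hxy (Finset.mem_coe.mpr (Finset.mem_sdiff.mpr ⟨hy, hyB⟩))
    exact (Finset.mem_sdiff.mp (Finset.mem_coe.mp h)).2 hx
  have hrim : ∀ x ∈ B, x.2 + 1 = beadsAbove X (diagIndex n x) := by
    intro x hx
    obtain ⟨h1, h2⟩ := hmem x hx
    by_contra hne
    have h3 := beadsAbove_le_card X (diagIndex n x)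
    have h4 : diagIndex n (x.1 + 1, x.2 + 1) = diagIndex n x := by
      simp only [diagIndex]
      omega
    have h5 : (x.1 + 1, x.2 + 1) ∈ shape n X := by
      rw [mem_shape, h4]
      dsimp only
      omega
    have h6 := hclosed x hx _ h5 ⟨Nat.le_succ _, Nat.le_succ _⟩
    have h7 := hB.eq_of_diag_eq hx h6 (by simp only [diag]; push_cast; ring)
    have h8 := congrArg Prod.fst h7
    dsimp only at h8
    omega
  have hinj : Set.InjOn (diagIndex n) B := by
    intro x hx y hy hxy
    refine hB.eq_of_diag_eq hx hy ?_
    have h1 := hdiag x hx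
    have h2 := hdiag y hy
    omega
  have hne : B.Nonempty := Finset.card_pos.mp (by omega)
  obtain ⟨w, hw, hwmin⟩ := B.exists_min_image (diagIndex n) hne
  have himage : B.image (diagIndex n) = Finset.Ico (diagIndex n w) (diagIndex n w + n) := by
    refine eq_Ico_of_card_eq ?_ ?_ ?_
    · rw [Finset.card_image_of_injOn hinj, hcard]
    · intro k hk
      obtain ⟨x, hx, rfl⟩ := Finset.mem_image.mp hk
      exact hwmin x hx
    · intro k hk hlt
      obtain ⟨x, hx, rfl⟩ := Finset.mem_image.mp hk
      have h1 := hdiag x hx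
      have h2 := hdiag w hw
      have h3 := (hmem x hx).1
      rcases hB.exists_mem_diag_eq_sub_one hw hx (by omega) with h | ⟨i, hi, h⟩
      · refine Finset.mem_image.mpr ⟨_, h, ?_⟩
        have h4 := (hmem _ h).1
        simp only [diagIndex] at h4 ⊢
        omega
      · refine Finset.mem_image.mpr ⟨_, h, ?_⟩
        simp only [diagIndex]
        omega
  have hIco : ∀ x ∈ B, diagIndex n x ∈ Finset.Ico (diagIndex n w) (diagIndex n w + n) :=
    fun x hx => himage ▸ Finset.mem_image_of_mem _ hx
  refine ⟨diagIndex n w, ?_, ?_, ?_⟩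
  · intro hwX
    have h1 := hrim w hw
    have h2 := (hmem w hw).1
    rcases Nat.eq_zero_or_pos (diagIndex n w) with h0 | h0
    · rw [h0] at hwX h1
      have h3 := beadsAbove_zero_lt hwX
      simp only [diagIndex] at h0
      omega
    · have h3 := beadsAbove_eq_succ_add X (diagIndex n w - 1)
      rw [Nat.sub_add_cancel h0, if_pos hwX] at h3
      have h4 := beadsAbove_le_card X (diagIndex n w - 1)
      have h5 : diagIndex n (w.1, w.2 + 1) = diagIndex n w - 1 := by
        simp only [diagIndex]
        omega
      have h6 : (w.1, w.2 + 1) ∈ shape n X := by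
        rw [mem_shape, h5]
        dsimp only
        omega
      have h7 := hclosed w hw _ h6 ⟨le_rfl, Nat.le_succ _⟩
      have h8 := (Finset.mem_Ico.mp (hIco _ h7)).1
      omega
  · have hlast : diagIndex n w + (n - 1) ∈ B.image (diagIndex n) := by
      rw [himage, Finset.mem_Ico]
      omega
    obtain ⟨x, hx, hxk⟩ := Finset.mem_image.mp hlast
    by_contra hnX
    have h3 := beadsAbove_eq_succ_add X (diagIndex n x)
    rw [if_neg (by rwa [hxk, add_assoc, Nat.sub_add_cancel hn])] at h3
    have h5 : diagIndex n (x.1 + 1, x.2) = diagIndex n x + 1 := by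
      simp only [diagIndex]
      omega
    obtain ⟨h1, h2⟩ := hmem x hx
    have h6 : (x.1 + 1, x.2) ∈ shape n X := by
      rw [mem_shape, h5]
      dsimp only
      omega
    have h7 := hclosed x hx _ h6 ⟨Nat.le_succ _, le_rfl⟩
    have h8 := (Finset.mem_Ico.mp (hIco _ h7)).2
    omega
  · refine Finset.eq_of_subset_of_card_le (fun x hx => ?_) ?_
    · refine Finset.mem_image.mpr ⟨diagIndex n x, hIco x hx, ?_⟩
      have h1 := hrim x hx
      have h2 := (hmem x hx).1
      refine Prod.ext ?_ ?_
      · simp only [rimBox, ← h1]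
        simp only [diagIndex]
        omega
      · simp only [rimBox, ← h1]
        omega
    · refine Finset.card_image_le.trans ?_
      rw [Nat.card_Ico, hcard]
      omega

end Removable

end Beads

/-! ### Removing a part from a tiling -/

section Tilings

open scoped Classical in
/-- The tilings of `D` by border-strips with `n` boxes each. -/
noncomputable def tilings (n : ℕ) (D : Finset (ℕ × ℕ)) : Finset (Finset (Finset (ℕ × ℕ))) :=
  D.powerset.powerset.filter (IsStripTiling n D)

theorem mem_tilings {n : ℕ} {D : Finset (ℕ × ℕ)} {P : Finset (Finset (ℕ × ℕ))} :
    P ∈ tilings n D ↔ IsStripTiling n D P := by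
  simp only [tilings, Finset.mem_filter, Finset.mem_powerset, and_iff_right_iff_imp]
  exact fun hP B hB => Finset.mem_powerset.mpr (hP.subset hB)

theorem IsStripTiling.erase {n : ℕ} {D B : Finset (ℕ × ℕ)} {P : Finset (Finset (ℕ × ℕ))}
    (hP : IsStripTiling n D P) (hB : B ∈ P) : IsStripTiling n (D \ B) (P.erase B) where
  isBorderStrip C hC := hP.isBorderStrip C (Finset.mem_of_mem_erase hC)
  card_eq C hC := hP.card_eq C (Finset.mem_of_mem_erase hC)
  eq_of_mem C hC C' hC' :=
    hP.eq_of_mem C (Finset.mem_of_mem_erase hC) C' (Finset.mem_of_mem_erase hC')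
  mem_iff x := by
    rw [Finset.mem_sdiff, hP.mem_iff]
    constructor
    · rintro ⟨⟨C, hC, hx⟩, hxB⟩
      exact ⟨C, Finset.mem_erase.mpr ⟨fun h => hxB (h ▸ hx), hC⟩, hx⟩
    · rintro ⟨C, hC, hx⟩
      obtain ⟨hne, hC⟩ := Finset.mem_erase.mp hC
      exact ⟨⟨C, hC, hx⟩, fun hxB => hne (hP.eq_of_mem C hC B hB x hx hxB)⟩

theorem IsStripTiling.insert {n : ℕ} {D B : Finset (ℕ × ℕ)} {P : Finset (Finset (ℕ × ℕ))}
    (hP : IsStripTiling n (D \ B) P) (hB : IsBorderStrip B) (hcard : B.card = n) (hsub : B ⊆ D) :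
    IsStripTiling n D (insert B P) where
  isBorderStrip C hC := by
    rcases Finset.mem_insert.mp hC with rfl | hC
    · exact hB
    · exact hP.isBorderStrip C hC
  card_eq C hC := by
    rcases Finset.mem_insert.mp hC with rfl | hC
    · exact hcard
    · exact hP.card_eq C hC
  eq_of_mem C hC C' hC' x hx hx' := by
    rcases Finset.mem_insert.mp hC with h | h <;>
      rcases Finset.mem_insert.mp hC' with h' | h'
    · rw [h, h']
    · exact absurd (h ▸ hx) (Finset.mem_sdiff.mp (hP.subset h' hx')).2
    · exact absurd (h' ▸ hx') (Finset.mem_sdiff.mp (hP.subset h hx)).2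
    · exact hP.eq_of_mem C h C' h' x hx hx'
  mem_iff x := by
    rw [Finset.exists_mem_insert, ← hP.mem_iff, Finset.mem_sdiff]
    constructor
    · intro hx
      by_cases hxB : x ∈ B
      · exact Or.inl hxB
      · exact Or.inr ⟨hx, hxB⟩
    · rintro (hx | hx)
      · exact hsub hx
      · exact hx.1

/-- Tilings of `D` containing the strip `B` correspond to tilings of `D \ B`. -/
theorem card_filter_tilings {n : ℕ} (hn : 0 < n) {D B : Finset (ℕ × ℕ)} (hB : IsBorderStrip B)
    (hcard : B.card = n) (hsub : B ⊆ D) (q : Finset (Finset (ℕ × ℕ)) → Prop)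
    [DecidablePred q] :
    ((tilings n D).filter fun P => B ∈ P ∧ q (P.erase B)).card =
      ((tilings n (D \ B)).filter q).card := by
  have hnot : ∀ P ∈ tilings n (D \ B), B ∉ P := by
    intro P hP hBP
    obtain ⟨x, hx⟩ : B.Nonempty := Finset.card_pos.mp (by omega)
    exact (Finset.mem_sdiff.mp ((mem_tilings.mp hP).subset hBP hx)).2 hx
  refine Finset.card_bij' (fun P _ => P.erase B) (fun P _ => insert B P) ?_ ?_ ?_ ?_
  · intro P hP
    obtain ⟨hP, hBP, hq⟩ := Finset.mem_filter.mp hP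
    exact Finset.mem_filter.mpr ⟨mem_tilings.mpr ((mem_tilings.mp hP).erase hBP), hq⟩
  · intro P hP
    obtain ⟨hP, hq⟩ := Finset.mem_filter.mp hP
    refine Finset.mem_filter.mpr ⟨mem_tilings.mpr ((mem_tilings.mp hP).insert hB hcard hsub),
      Finset.mem_insert_self _ _, ?_⟩
    rwa [Finset.erase_insert (hnot P hP)]
  · intro P hP
    exact Finset.insert_erase (Finset.mem_filter.mp hP).2.1
  · intro P hP
    exact Finset.erase_insert (hnot P (Finset.mem_filter.mp hP).1)

end Tilings

/-! ### The recursion for the number of tilings -/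

section Levels

open Function (update)

variable {n : ℕ} {l : ℕ → ℕ}

/-- The bead set with one bead in each residue class modulo `n`, the bead of the class of `i` being
`l i` steps above its lowest position. -/
def beadSet (n : ℕ) (l : ℕ → ℕ) : Finset ℕ := (Finset.range n).image fun i => i + n * l i

theorem mem_beadSet {b : ℕ} : b ∈ beadSet n l ↔ ∃ i < n, i + n * l i = b := by
  simp [beadSet]

theorem eq_and_eq_of_add_mul_eq {i j a b : ℕ} (hi : i < n) (hj : j < n)
    (h : i + n * a = j + n * b) : i = j ∧ a = b := by
  have h1 : i = j := by
    have := congrArg (· % n) h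
    simpa [Nat.add_mul_mod_self_left, Nat.mod_eq_of_lt hi, Nat.mod_eq_of_lt hj] using this
  subst h1
  exact ⟨rfl, Nat.eq_of_mul_eq_mul_left (by omega) (Nat.add_left_cancel h)⟩

theorem card_beadSet : (beadSet n l).card = n := by
  rw [beadSet, Finset.card_image_of_injOn, Finset.card_range]
  intro i hi j hj h
  exact (eq_and_eq_of_add_mul_eq (Finset.mem_range.mp hi) (Finset.mem_range.mp hj) h).1

/-- The position to which the bead of the class of `i` moves when it is lowered by one step;
it is used only for `l i ≠ 0`. -/
def lowerPos (n : ℕ) (l : ℕ → ℕ) (i : ℕ) : ℕ := i + n * (l i - 1)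

theorem lowerPos_add (i : ℕ) (hl : l i ≠ 0) : lowerPos n l i + n = i + n * l i := by
  obtain ⟨v, hv⟩ := Nat.exists_eq_succ_of_ne_zero hl
  rw [lowerPos, hv, Nat.succ_sub_one, Nat.mul_succ]
  omega

theorem lowerPos_add_mem {i : ℕ} (hi : i < n) (hl : l i ≠ 0) :
    lowerPos n l i + n ∈ beadSet n l :=
  mem_beadSet.mpr ⟨i, hi, (lowerPos_add i hl).symm⟩

theorem lowerPos_notMem {i : ℕ} (hi : i < n) (hl : l i ≠ 0) : lowerPos n l i ∉ beadSet n l := by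
  intro h
  obtain ⟨j, hj, h⟩ := mem_beadSet.mp h
  obtain ⟨rfl, h⟩ := eq_and_eq_of_add_mul_eq hj hi h
  omega

theorem moveBead_beadSet {i : ℕ} (hi : i < n) (hl : l i ≠ 0) :
    moveBead n (beadSet n l) (lowerPos n l i) = beadSet n (update l i (l i - 1)) := by
  ext b
  rw [moveBead, Finset.mem_insert, Finset.mem_erase, mem_beadSet, mem_beadSet, lowerPos_add i hl]
  constructor
  · rintro (rfl | ⟨hne, j, hj, rfl⟩)
    · exact ⟨i, hi, by rw [Function.update_self, lowerPos]⟩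
    · have hji : j ≠ i := by
        rintro rfl
        exact hne rfl
      exact ⟨j, hj, by rw [Function.update_of_ne hji]⟩
  · rintro ⟨j, hj, rfl⟩
    by_cases hji : j = i
    · subst hji
      exact Or.inl (by rw [Function.update_self, lowerPos])
    · rw [Function.update_of_ne hji]
      exact Or.inr ⟨fun h => hji (eq_and_eq_of_add_mul_eq hj hi h).1, j, hj, rfl⟩

/-- The diagram of a level function. -/
def levelShape (n : ℕ) (l : ℕ → ℕ) : Finset (ℕ × ℕ) := shape n (beadSet n l)

/-- The border-strip removed from the diagram when the label `i` is lowered. -/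
def levelStrip (n : ℕ) (l : ℕ → ℕ) (i : ℕ) : Finset (ℕ × ℕ) :=
  rimStrip n (beadSet n l) (lowerPos n l i)

theorem isBorderStrip_levelStrip {i : ℕ} (hi : i < n) (hl : l i ≠ 0) :
    IsBorderStrip (levelStrip n l i) :=
  isBorderStrip_rimStrip (by omega) card_beadSet (lowerPos_notMem hi hl) (lowerPos_add_mem hi hl)

theorem card_levelStrip {i : ℕ} (hi : i < n) (hl : l i ≠ 0) : (levelStrip n l i).card = n :=
  card_rimStrip card_beadSet (lowerPos_notMem hi hl) (lowerPos_add_mem hi hl)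

theorem levelStrip_subset {i : ℕ} (hi : i < n) (hl : l i ≠ 0) :
    levelStrip n l i ⊆ levelShape n l :=
  rimStrip_subset_shape card_beadSet (lowerPos_notMem hi hl) (lowerPos_add_mem hi hl)

theorem levelShape_sdiff_levelStrip {i : ℕ} (hi : i < n) (hl : l i ≠ 0) :
    levelShape n l \ levelStrip n l i = levelShape n (update l i (l i - 1)) := by
  rw [levelShape, levelStrip,
    shape_sdiff_rimStrip card_beadSet (lowerPos_notMem hi hl) (lowerPos_add_mem hi hl),
    moveBead_beadSet hi hl, levelShape]

theorem exists_levelStrip_mem {P : Finset (Finset (ℕ × ℕ))}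
    (hP : IsStripTiling n (levelShape n l) P) (h : ∃ i < n, l i ≠ 0) :
    ∃ i < n, l i ≠ 0 ∧ levelStrip n l i ∈ P := by
  obtain ⟨i, hi, hli⟩ := h
  have hne : (levelShape n l).Nonempty := by
    refine (Finset.card_pos.mp ?_).mono (levelStrip_subset hi hli)
    rw [card_levelStrip hi hli]
    omega
  obtain ⟨B, hB, hlow⟩ := hP.exists_isLowerSet_sdiff (isLowerSet_shape n _) hne
  obtain ⟨p, hp1, hp2, hBp⟩ := exists_eq_rimStrip (by omega) card_beadSet (hP.isBorderStrip B hB)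
    (hP.card_eq B hB) (hP.subset hB) hlow
  obtain ⟨j, hj, hjp⟩ := mem_beadSet.mp hp2
  have hlj : l j ≠ 0 := by
    intro h0
    rw [h0] at hjp
    omega
  refine ⟨j, hj, hlj, ?_⟩
  have hp : lowerPos n l j = p := by
    have := lowerPos_add (n := n) j hlj
    omega
  rw [levelStrip, hp, ← hBp]
  exact hB

/-- Two removable strips of the same tiling occupy disjoint sets of diagonals. -/
theorem lowerPos_add_le_or {P : Finset (Finset (ℕ × ℕ))}
    (hP : IsStripTiling n (levelShape n l) P) {i j : ℕ} (hi : i < n) (hj : j < n)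
    (hli : l i ≠ 0) (hlj : l j ≠ 0) (hiP : levelStrip n l i ∈ P) (hjP : levelStrip n l j ∈ P)
    (hij : i ≠ j) :
    lowerPos n l i + n ≤ lowerPos n l j ∨ lowerPos n l j + n ≤ lowerPos n l i := by
  by_contra hcon
  push Not at hcon
  have hle : ∀ {a b : ℕ}, a < n → b < n → l a ≠ 0 → l b ≠ 0 →
      levelStrip n l a = levelStrip n l b → lowerPos n l b ≤ lowerPos n l a := by
    intro a b ha hb hla hlb hab
    have hmem : lowerPos n l a ∈ Finset.Ico (lowerPos n l a) (lowerPos n l a + n) :=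
      Finset.mem_Ico.mpr ⟨le_rfl, by omega⟩
    have h1 : rimBox n (beadSet n l) (lowerPos n l a) ∈ levelStrip n l b :=
      hab ▸ Finset.mem_image_of_mem _ hmem
    obtain ⟨m, hm, hmeq⟩ := Finset.mem_image.mp h1
    have h2 := diagIndex_rimBox card_beadSet (lowerPos_notMem hb hlb) (lowerPos_add_mem hb hlb) hm
    have h3 := diagIndex_rimBox card_beadSet (lowerPos_notMem ha hla) (lowerPos_add_mem ha hla) hmem
    rw [hmeq, h3] at h2
    have := (Finset.mem_Ico.mp hm).1
    omega
  have heq : levelStrip n l i = levelStrip n l j := by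
    refine hP.eq_of_mem _ hiP _ hjP
      (rimBox n (beadSet n l) (max (lowerPos n l i) (lowerPos n l j))) ?_ ?_ <;>
      exact Finset.mem_image_of_mem _ (Finset.mem_Ico.mpr (by omega))
  have h1 := hle hi hj hli hlj heq
  have h2 := hle hj hi hlj hli heq.symm
  have h3 : i + n * (l i - 1) = j + n * (l j - 1) := le_antisymm h2 h1
  exact hij (eq_and_eq_of_add_mul_eq hi hj h3).1

/-- Lowering a smaller label of level one does not change the strip of a label of level two, which
lies on later diagonals. -/
theorem levelStrip_update {i j : ℕ} (hij : i < j) (hj : j < n) (hli : l i = 1) (hlj : l j = 2) :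
    levelStrip n (update l i 0) j = levelStrip n l j := by
  have hi : i < n := hij.trans hj
  have hli0 : l i ≠ 0 := by omega
  have hpos : lowerPos n (update l i 0) j = lowerPos n l j := by
    rw [lowerPos, lowerPos, Function.update_of_ne (by omega)]
  rw [levelStrip, levelStrip, hpos, rimStrip, rimStrip]
  refine Finset.image_congr fun k hk => ?_
  have hk := (Finset.mem_Ico.mp (Finset.mem_coe.mp hk)).1
  have h1 := beadsAbove_moveBead (lowerPos_notMem hi hli0) (lowerPos_add_mem hi hli0) k
  have h2 := lowerPos_add (n := n) i hli0
  have h3 := lowerPos_add (n := n) j (l := l) (by omega)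
  rw [hli] at h2
  rw [hlj] at h3
  rw [moveBead_beadSet hi hli0, if_neg (by omega), hli, Nat.sub_self, add_zero] at h1
  rw [rimBox, rimBox, h1]

/-- The number of tilings of the diagram of a level function. -/
noncomputable def tilingCount (n : ℕ) (l : ℕ → ℕ) : ℕ := (tilings n (levelShape n l)).card

theorem card_filter_levelStrip_mem {i : ℕ} (hi : i < n) (hl : l i ≠ 0) :
    ((tilings n (levelShape n l)).filter fun P => levelStrip n l i ∈ P).card =
      tilingCount n (update l i (l i - 1)) := by
  have h := card_filter_tilings (by omega) (isBorderStrip_levelStrip hi hl)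
    (card_levelStrip hi hl) (levelStrip_subset hi hl) fun _ => True
  simpa only [tilingCount, and_true, Finset.filter_true, levelShape_sdiff_levelStrip hi hl] using h

theorem card_filter_levelStrip_mem_and {i j : ℕ} (hij : i < j) (hj : j < n) (hli : l i = 1)
    (hlj : l j = 2) :
    ((tilings n (levelShape n l)).filter
        fun P => levelStrip n l i ∈ P ∧ levelStrip n l j ∈ P).card =
      tilingCount n (update (update l i 0) j 1) := by
  have hi : i < n := hij.trans hj
  have hli0 : l i ≠ 0 := by omega
  have hlj0 : update l i 0 j = 2 := by rw [Function.update_of_ne (by omega), hlj]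
  have h := card_filter_tilings (by omega) (isBorderStrip_levelStrip hi hli0)
    (card_levelStrip hi hli0) (levelStrip_subset hi hli0) fun P => levelStrip n l j ∈ P
  rw [levelShape_sdiff_levelStrip hi hli0, hli, Nat.sub_self] at h
  have h' := card_filter_levelStrip_mem (n := n) (l := update l i 0) hj (by omega)
  rw [levelStrip_update hij hj hli hlj, hlj0] at h'
  rw [← h', ← h]
  congr 1
  refine Finset.filter_congr fun P hP => and_congr_right fun hiP => ?_
  rw [Finset.mem_erase, and_iff_right]
  intro heq
  have h1 : levelStrip n l j ⊆ levelShape n l \ levelStrip n l i := by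
    rw [levelShape_sdiff_levelStrip hi hli0, hli, Nat.sub_self, ← levelStrip_update hij hj hli hlj]
    exact levelStrip_subset hj (by omega)
  rw [heq] at h1
  obtain ⟨x, hx⟩ : (levelStrip n l i).Nonempty :=
    Finset.card_pos.mp (by rw [card_levelStrip hi hli0]; omega)
  exact (Finset.mem_sdiff.mp (h1 hx)).2 hx

/-- A tiling contains one or two removable strips, and in the latter case one of them belongs to a
label of level one and the other one to a larger label of level two. -/
theorem sum_removable_eq_one (hl : ∀ i, l i ≤ 2) (h : ∃ i < n, l i ≠ 0)
    {P : Finset (Finset (ℕ × ℕ))} (hP : IsStripTiling n (levelShape n l) P) :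
    (1 : ℚ) = (∑ i ∈ Finset.range n, if l i = 1 ∧ levelStrip n l i ∈ P then 1 else 0) +
      (∑ j ∈ Finset.range n, if l j = 2 ∧ levelStrip n l j ∈ P then 1 else 0) -
      ∑ j ∈ Finset.range n, ∑ i ∈ Finset.range j, if (l i = 1 ∧ l j = 2) ∧
        levelStrip n l i ∈ P ∧ levelStrip n l j ∈ P then 1 else 0 := by
  have hsep : ∀ {i j : ℕ}, i < n → j < n → l i ≠ 0 → l j ≠ 0 → levelStrip n l i ∈ P →
      levelStrip n l j ∈ P → i ≠ j → i + n * l i ≤ lowerPos n l j ∨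
        j + n * l j ≤ lowerPos n l i := by
    intro i j hi hj hli hlj hiP hjP hij
    rw [← lowerPos_add i hli, ← lowerPos_add j hlj]
    exact lowerPos_add_le_or hP hi hj hli hlj hiP hjP hij
  -- Two removable strips always form a pair of the right kind, so the double sum factors.
  have hdouble : (∑ j ∈ Finset.range n, ∑ i ∈ Finset.range j, if (l i = 1 ∧ l j = 2) ∧
        levelStrip n l i ∈ P ∧ levelStrip n l j ∈ P then (1 : ℚ) else 0) =
      (∑ i ∈ Finset.range n, if l i = 1 ∧ levelStrip n l i ∈ P then 1 else 0) *
      ∑ j ∈ Finset.range n, if l j = 2 ∧ levelStrip n l j ∈ P then 1 else 0 := by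
    rw [Finset.mul_sum]
    refine Finset.sum_congr rfl fun j hj => ?_
    have hj := Finset.mem_range.mp hj
    rw [Finset.sum_mul, ← Finset.sum_subset (Finset.range_subset_range.mpr hj.le)]
    · refine Finset.sum_congr rfl fun i _ => ?_
      split_ifs <;> simp <;> tauto
    · intro i hi hij
      have hi := Finset.mem_range.mp hi
      rw [Finset.mem_range] at hij
      rw [mul_ite, mul_one, mul_zero]
      split_ifs with h1 h2
      · exfalso
        have hne : i ≠ j := by
          rintro rfl
          omega
        have h3 := hsep hi hj (by omega) (by omega) h2.2 h1.2 hne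
        rw [lowerPos, lowerPos, h1.1, h2.1] at h3
        omega
      · rfl
      · rfl
  have hcard : ∀ v, (v = 1 ∨ v = 2) →
      ((Finset.range n).filter fun i => l i = v ∧ levelStrip n l i ∈ P).card ≤ 1 := by
    intro v hv
    rw [Finset.card_le_one]
    intro i hi j hj
    by_contra hne
    obtain ⟨hi, hiv, hiP⟩ := Finset.mem_filter.mp hi
    obtain ⟨hj, hjv, hjP⟩ := Finset.mem_filter.mp hj
    rw [Finset.mem_range] at hi hj
    have h3 := hsep hi hj (by omega) (by omega) hiP hjP hne
    rw [lowerPos, lowerPos, hiv, hjv] at h3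
    rcases hv with rfl | rfl <;> omega
  have hpos : 0 < ((Finset.range n).filter fun i => l i = 1 ∧ levelStrip n l i ∈ P).card +
      ((Finset.range n).filter fun i => l i = 2 ∧ levelStrip n l i ∈ P).card := by
    obtain ⟨i, hi, hli, hiP⟩ := exists_levelStrip_mem hP h
    have hli2 := hl i
    obtain h1 | h2 : l i = 1 ∨ l i = 2 := by omega
    · exact Nat.add_pos_left (Finset.card_pos.mpr
        ⟨i, Finset.mem_filter.mpr ⟨Finset.mem_range.mpr hi, h1, hiP⟩⟩) _
    · exact Nat.add_pos_right _ (Finset.card_pos.mpr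
        ⟨i, Finset.mem_filter.mpr ⟨Finset.mem_range.mpr hi, h2, hiP⟩⟩)
  rw [hdouble, Finset.sum_boole, Finset.sum_boole]
  have hc1 := hcard 1 (Or.inl rfl)
  have hc2 := hcard 2 (Or.inr rfl)
  generalize ((Finset.range n).filter fun i => l i = 1 ∧ levelStrip n l i ∈ P).card = a at *
  generalize ((Finset.range n).filter fun i => l i = 2 ∧ levelStrip n l i ∈ P).card = b at *
  interval_cases a <;> interval_cases b <;> simp at hpos ⊢

/-- Inclusion-exclusion over the removable strips of a tiling. -/
theorem tilingCount_rec (hl : ∀ i, l i ≤ 2) (h : ∃ i < n, l i ≠ 0) :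
    (tilingCount n l : ℚ) =
      (∑ i ∈ Finset.range n, if l i = 1 then (tilingCount n (update l i 0) : ℚ) else 0) +
      (∑ j ∈ Finset.range n, if l j = 2 then (tilingCount n (update l j 1) : ℚ) else 0) -
      ∑ j ∈ Finset.range n, ∑ i ∈ Finset.range j,
        if l i = 1 ∧ l j = 2 then (tilingCount n (update (update l i 0) j 1) : ℚ) else 0 := by
  have hsum : ∀ (a : Prop) [Decidable a] (q : Finset (Finset (ℕ × ℕ)) → Prop) [DecidablePred q],
      (∑ P ∈ tilings n (levelShape n l), if a ∧ q P then (1 : ℚ) else 0) =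
        if a then (((tilings n (levelShape n l)).filter q).card : ℚ) else 0 := by
    intro a _ q _
    by_cases ha : a
    · simp [ha]
    · simp [ha]
  rw [tilingCount, Finset.card_eq_sum_ones, Nat.cast_sum, Nat.cast_one,
    Finset.sum_congr rfl fun P hP => sum_removable_eq_one hl h (mem_tilings.mp hP),
    Finset.sum_sub_distrib, Finset.sum_add_distrib, Finset.sum_comm (s := tilings n _),
    Finset.sum_comm (s := tilings n _), Finset.sum_comm (s := tilings n _)]
  refine congrArg₂ _ (congrArg₂ _ ?_ ?_) ?_
  · refine Finset.sum_congr rfl fun i hi => ?_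
    rw [hsum]
    split_ifs with h1
    · rw [card_filter_levelStrip_mem (Finset.mem_range.mp hi) (by omega), h1]
    · rfl
  · refine Finset.sum_congr rfl fun j hj => ?_
    rw [hsum]
    split_ifs with h1
    · rw [card_filter_levelStrip_mem (Finset.mem_range.mp hj) (by omega), h1]
    · rfl
  · refine Finset.sum_congr rfl fun j hj => ?_
    rw [Finset.sum_comm]
    refine Finset.sum_congr rfl fun i hi => ?_
    rw [hsum]
    split_ifs with h1
    · rw [card_filter_levelStrip_mem_and (Finset.mem_range.mp hi) (Finset.mem_range.mp hj) h1.1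
        h1.2]
    · rfl

theorem tilings_empty (hn : 0 < n) : tilings n ∅ = {∅} := by
  ext P
  rw [mem_tilings, Finset.mem_singleton]
  constructor
  · intro hP
    refine Finset.eq_empty_of_forall_notMem fun B hB => ?_
    have h1 := Finset.subset_empty.mp (hP.subset hB)
    have h2 := hP.card_eq B hB
    rw [h1, Finset.card_empty] at h2
    omega
  · rintro rfl
    exact ⟨by simp, by simp, by simp, by simp⟩

theorem levelShape_of_eq_zero (h : ∀ i < n, l i = 0) : levelShape n l = ∅ := by
  have hX : beadSet n l = Finset.range n := by
    ext b
    rw [mem_beadSet, Finset.mem_range]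
    constructor
    · rintro ⟨i, hi, rfl⟩
      rw [h i hi]
      omega
    · intro hb
      exact ⟨b, hb, by rw [h b hb]; omega⟩
  refine Finset.eq_empty_of_forall_notMem fun x hx => ?_
  rw [levelShape, mem_shape, hX, beadsAbove] at hx
  have h1 : (Finset.range n).filter (diagIndex n x < ·) = Finset.Ico (diagIndex n x + 1) n := by
    ext b
    simp only [Finset.mem_filter, Finset.mem_range, Finset.mem_Ico]
    omega
  rw [h1, Nat.card_Ico] at hx
  simp only [diagIndex] at hx
  omega

theorem levelShape_two : levelShape n (fun _ => 2) = rectangle (2 * n) n := by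
  have hX : beadSet n (fun _ => 2) = Finset.Ico (2 * n) (3 * n) := by
    ext b
    rw [mem_beadSet, Finset.mem_Ico]
    constructor
    · rintro ⟨i, hi, rfl⟩
      omega
    · intro hb
      exact ⟨b - 2 * n, by omega, by omega⟩
  ext x
  have h1 : (Finset.Ico (2 * n) (3 * n)).filter (diagIndex n x < ·) =
      Finset.Ico (max (2 * n) (diagIndex n x + 1)) (3 * n) := by
    ext b
    simp only [Finset.mem_filter, Finset.mem_Ico]
    omega
  rw [levelShape, mem_shape, hX, beadsAbove, h1, Nat.card_Ico, rectangle, Finset.mem_product,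
    Finset.mem_range, Finset.mem_range]
  simp only [diagIndex]
  omega

theorem tilingCount_eq_stateCount (hn : 0 < n) (hl : ∀ i, l i ≤ 2) :
    (tilingCount n l : ℚ) = stateCount n l := by
  induction hs : ∑ i ∈ Finset.range n, l i using Nat.strong_induction_on generalizing l with
  | _ s ih =>
    by_cases h : ∃ i < n, l i ≠ 0
    · have hlow : ∀ {l : ℕ → ℕ} {i v : ℕ}, i < n → v < l i →
          ∑ k ∈ Finset.range n, update l i v k < ∑ k ∈ Finset.range n, l k := by
        intro l i v hi hv
        refine Finset.sum_lt_sum (fun k _ => ?_) ⟨i, Finset.mem_range.mpr hi, ?_⟩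
        · by_cases hk : k = i
          · subst hk
            rw [Function.update_self]
            exact hv.le
          · rw [Function.update_of_ne hk]
        · rwa [Function.update_self]
      have hbound : ∀ {l : ℕ → ℕ} {i v : ℕ}, (∀ k, l k ≤ 2) → v ≤ 2 →
          ∀ k, update l i v k ≤ 2 := by
        intro l i v hl hv k
        by_cases hk : k = i
        · subst hk
          rwa [Function.update_self]
        · rw [Function.update_of_ne hk]
          exact hl k
      rw [tilingCount_rec hl h, stateCount_rec hl h]
      congr 1
      · congr 1
        · refine Finset.sum_congr rfl fun i hi => ?_
          split_ifs with h1
          · exact ih _ (hs ▸ hlow (Finset.mem_range.mp hi) (by omega)) (hbound hl (by omega)) rfl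
          · rfl
        · refine Finset.sum_congr rfl fun i hi => ?_
          split_ifs with h1
          · exact ih _ (hs ▸ hlow (Finset.mem_range.mp hi) (by omega)) (hbound hl (by omega)) rfl
          · rfl
      · refine Finset.sum_congr rfl fun j hj => Finset.sum_congr rfl fun i hi => ?_
        have hi := Finset.mem_range.mp hi
        have hj := Finset.mem_range.mp hj
        split_ifs with h1
        · refine ih _ (hs ▸ (hlow hj ?_).trans (hlow (hi.trans hj) ?_))
            (hbound (hbound hl (by omega)) (by omega)) rfl
          · rw [Function.update_of_ne (by omega)]
            omega
          · omega
        · rfl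
    · push Not at h
      rw [stateCount_of_eq_zero h, tilingCount, levelShape_of_eq_zero h, tilings_empty hn]
      simp

end Levels

/-! ### Border-strip decompositions of the rectangle -/

section Decompositions

variable {n : ℕ}

theorem isStripTiling_parts {D : Finset (ℕ × ℕ)} {m : ℕ} {Q : Finpartition D}
    (hQ : Q ∈ BSD D (Multiset.replicate m n)) : IsStripTiling n D Q.parts where
  isBorderStrip := hQ.1
  card_eq B hB := by
    have h : B.card ∈ Multiset.replicate m n := hQ.2 ▸ Multiset.mem_map_of_mem _ hB
    exact Multiset.eq_of_mem_replicate h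
  eq_of_mem B hB C hC x hxB hxC := Q.eq_of_mem_parts hB hC hxB hxC
  mem_iff x := ⟨fun hx => Q.exists_mem hx, fun ⟨_, hB, hx⟩ => Q.le hB hx⟩

theorem exists_parts_eq (hn : 0 < n) {D : Finset (ℕ × ℕ)} {m : ℕ} (hD : D.card = m * n)
    {P : Finset (Finset (ℕ × ℕ))} (hP : IsStripTiling n D P) :
    ∃ Q ∈ BSD D (Multiset.replicate m n), Q.parts = P := by
  have hunique : ∀ x ∈ D, ∃! B, B ∈ P ∧ x ∈ B := fun x hx => by
    obtain ⟨B, hB, hxB⟩ := (hP.mem_iff x).mp hx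
    exact ⟨B, ⟨hB, hxB⟩, fun C hC => hP.eq_of_mem C hC.1 B hB x hC.2 hxB⟩
  have hempty : ∅ ∉ P := fun h => by
    have := hP.card_eq _ h
    rw [Finset.card_empty] at this
    omega
  let Q := Finpartition.ofExistsUnique P (fun B hB => hP.subset hB) hunique hempty
  refine ⟨Q, ⟨hP.isBorderStrip, Multiset.eq_replicate.mpr ⟨?_, fun k hk => ?_⟩⟩, rfl⟩
  · rw [Multiset.card_map, Finset.card_val]
    refine Nat.eq_of_mul_eq_mul_right hn ?_
    rw [← hD, ← Q.sum_card_parts, Finset.sum_const_nat (s := Q.parts) hP.card_eq]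
  · obtain ⟨B, hB, rfl⟩ := Multiset.mem_map.mp hk
    exact hP.card_eq B hB

theorem ncard_BSD_rectangle (hn : 0 < n) :
    (BSD (rectangle (2 * n) n) (Multiset.replicate (2 * n) n)).ncard =
      tilingCount n (fun _ => 2) := by
  have hinj : Function.Injective (Finpartition.parts : Finpartition (rectangle (2 * n) n) → _) :=
    fun P Q h => Finpartition.ext h
  rw [← Set.ncard_image_of_injective _ hinj, tilingCount, levelShape_two, ← Set.ncard_coe_finset]
  congr 1
  ext P
  rw [Finset.mem_coe, mem_tilings]
  constructor
  · rintro ⟨Q, hQ, rfl⟩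
    exact isStripTiling_parts hQ
  · intro hP
    exact exists_parts_eq hn (by simp [rectangle]) hP

theorem ncard_BSD_rectangle_zero :
    (BSD (rectangle (2 * 0) 0) (Multiset.replicate (2 * 0) 0)).ncard = 1 := by
  have key : ∀ D : Finset (ℕ × ℕ), D = ∅ → (BSD D (Multiset.replicate (2 * 0) 0)).ncard = 1 := by
    rintro _ rfl
    rw [Set.ncard_eq_one]
    refine ⟨Finpartition.empty _, Set.eq_singleton_iff_unique_mem.mpr ⟨⟨?_, ?_⟩, fun Q _ => ?_⟩⟩
    · simp
    · simp
    · exact Subsingleton.elim (α := Finpartition (⊥ : Finset (ℕ × ℕ))) _ _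
  exact key _ (by simp [rectangle])

end Decompositions

end BorderStripCount

theorem mainTheorem1 (n : ℕ) :
    aSeq n = zografV (n + 3) ∧
      zografV (n + 3) =
        ((BSD (rectangle (2 * n) n) (Multiset.replicate (2 * n) n)).ncard : ℚ) := by
  refine ⟨BorderStripCount.aSeq_eq_zografV n, ?_⟩
  rcases Nat.eq_zero_or_pos n with rfl | hn
  · rw [BorderStripCount.ncard_BSD_rectangle_zero, zografV_three, Nat.cast_one]
  · rw [BorderStripCount.ncard_BSD_rectangle hn,
      BorderStripCount.tilingCount_eq_stateCount hn fun _ => le_rfl,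
      BorderStripCount.stateCount_two, ← BorderStripCount.aSeq_eq_zografV,
      BorderStripCount.aSeq_eq_besselNumber]
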